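/- Let $L$ be an arbitrary first-order language and let $T^\emptyset_L$ be the model companion of the empty $L$-theory. Explicitly, $T^\emptyset_L$ is axiomatized by the sentences $$\forall \overline{x}\,\Big(\textstyle\bigwedge_{i<j}x_i\neq x_j\rightarrow \exists\overline{y}\,\varphi_\Delta(\overline{x},\overline{y})\Big),$$ where $\Delta$ is any finite set of formulas of the form $R(\overline{z})$, $\lnot R(\overline{z})$ or $f(\overline{z})=z'$ in the variables $\overline{x}\,\overline{y}$ (constants are $0$-ary functions) such that $\Delta$ never contains both $R(\overline{z})$ and $\lnot R(\overline{z})$, never contains both $f(\overline{z})=z'$ and $f(\overline{z})=z''$ for distinct variables $z',z''$, and each $\overline{z}$ contains a variable from $\overline{y}$; here $\varphi_\Delta$ is the conjunction of $\Delta$ together with the statement that the entries of $\overline{x}\,\overline{y}$ are pairwise distinct. Let $\mathbb{M}\models T^\emptyset_L$ be a monster model: for some cardinal $\kappa>|L|+\aleph_0$, $\mathbb{M}$ is $\kappa$-saturated and strongly $\kappa$-homogeneous. Call a subset of $\mathbb{M}$ small if it has cardinality less than $\kappa$. In the following, $A,B,C,\dots$ denote subsets of $\mathbb{M}$, and $A'\equiv_B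 A$ means that some enumerations of $A'$ and $A$ have the same type over $B$. Define: - $A\perp^a_C B$ iff $\mathrm{acl}(CA)\cap\mathrm{acl}(CB)=\mathrm{acl}(C)$; - ($M$-dividing independence) $A\perp^M_C B$ iff $A\perp^a_{C'}B$ for all $C'$ with $C\subseteq C'\subseteq\mathrm{acl}(BC)$; - (thorn-forking independence) $A\perp^{\mathrm{th}}_C B$ iff for every small $B'\supseteq B$ there is $A'\equiv_{BC}A$ with $A'\perp^M_C B'$; - a formula $\varphi(x;b)$ divides over $C$ if there are $k<\omega$ and a sequence $(b_i)_{i<\omega}$ of realizations of $\mathrm{tp}(b/C)$ such that $\{\varphi(x;b_i)\mid i<\omega\}$ is $k$-inconsistent; a partial type divides over $C$ if it implies a formula that divides over $C$, and forks over $C$ if it implies a finite disjunction of formulas that divide over $C$; - (dividing independence) $A\perp^d_C B$ iff $\mathrm{tp}(A/BC)$ does not divide over $C$; (forking independence) $A\perp^f_C B$ iff $\mathrm{tp}(A/BC)$ does not fork over $C$. Then $\perp^M$ and $\perp^d$ satisfy extension over arbitrary small sets: for $\perp\in\{\perp^M,\perp^d\}$ and all small $A,B,C$ with $A\perp_C B$,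 and every small $B'\supseteq B$, there is $A'\equiv_{BC}A$ such that $A'\perp_C B'$. Consequently $\perp^M=\perp^{\mathrm{th}}$ and $\perp^d=\perp^f$, that is, for all small $A,B,C$, $A\perp^M_C B$ iff $A\perp^{\mathrm{th}}_C B$, and $A\perp^d_C B$ iff $A\perp^f_C B$. -/

import Mathlib

open FirstOrder

universe u v w

namespace GenericStructure

/-! ### The theory of the generic structure -/

/-- Flat literals in the variables `W`: `R(z)`, `¬ R(z)` and `f(z) = z'`.
Constant symbols are `0`-ary function symbols. -/
inductive FlatLiteral (L : FirstOrder.Language.{u, v}) (W : Type) : Type (max u v)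
  | rel {k : ℕ} (R : L.Relations k) (z : Fin k → W) : FlatLiteral L W
  | notRel {k : ℕ} (R : L.Relations k) (z : Fin k → W) : FlatLiteral L W
  | func {k : ℕ} (f : L.Functions k) (z : Fin k → W) (z' : W) : FlatLiteral L W

namespace FlatLiteral

variable {L : FirstOrder.Language.{u, v}} {W : Type}

/-- The first-order formula that a flat literal stands for. -/
def toFormula : FlatLiteral L W → L.Formula W
  | rel R z => R.formula fun i => FirstOrder.Language.Term.var (z i)
  | notRel R z => ∼(R.formula fun i => FirstOrder.Language.Term.var (z i))
  | func f z z' =>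
      FirstOrder.Language.Term.equal (FirstOrder.Language.Term.func f fun i => FirstOrder.Language.Term.var (z i))
        (FirstOrder.Language.Term.var z')

/-- Some variable of the tuple `z` lies in `Y`, where the literal is `R(z)`, `¬ R(z)` or
`f(z) = z'` (the value variable `z'` does not count). -/
def Meets (Y : Set W) : FlatLiteral L W → Prop
  | rel _ z => ∃ i, z i ∈ Y
  | notRel _ z => ∃ i, z i ∈ Y
  | func _ z _ => ∃ i, z i ∈ Y

end FlatLiteral

/-- Consistency of a flat diagram. -/
def FlatConsistent {L : FirstOrder.Language.{u, v}} {W : Type} (Δ : Set (FlatLiteral L W)) : Prop :=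
  (∀ (k : ℕ) (R : L.Relations k) (z : Fin k → W),
    ¬ (FlatLiteral.rel R z ∈ Δ ∧ FlatLiteral.notRel R z ∈ Δ)) ∧
  (∀ (k : ℕ) (f : L.Functions k) (z : Fin k → W) (z₁ z₂ : W),
    FlatLiteral.func f z z₁ ∈ Δ → FlatLiteral.func f z z₂ ∈ Δ → z₁ = z₂)

/-- Extension diagrams in `(x, y)`, with `x` of length `n` and `y` of length `m`: finite consistent
flat diagrams each of whose literals has an argument among the `y`-variables. -/
def IsExtensionDiagram {L : FirstOrder.Language.{u, v}} {n m : ℕ}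
    (Δ : Finset (FlatLiteral L (Fin n ⊕ Fin m))) : Prop :=
  FlatConsistent (Δ : Set (FlatLiteral L (Fin n ⊕ Fin m))) ∧
    ∀ ψ ∈ Δ, ψ.Meets (Set.range Sum.inr)

/-- The formula `δ(w)` saying that the entries of the finite tuple `w` are pairwise distinct. -/
noncomputable def nonredundant (L : FirstOrder.Language.{u, v}) (W : Type) [Finite W] : L.Formula W :=
  FirstOrder.Language.Formula.iInf fun p : {p : W × W // p.1 ≠ p.2} =>
    ∼(FirstOrder.Language.Term.equal (L := L) (FirstOrder.Language.Term.var p.1.1) (FirstOrder.Language.Term.var p.1.2))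

/-- The formula `φ_Δ(w)`: the conjunction of `Δ` together with `δ(w)`. -/
noncomputable def diagramFormula {L : FirstOrder.Language.{u, v}} {W : Type} [Finite W]
    (Δ : Finset (FlatLiteral L W)) : L.Formula W :=
  (FirstOrder.Language.Formula.iInf fun ψ : {ψ // ψ ∈ Δ} => ψ.1.toFormula) ⊓ nonredundant L W

/-- The sentence `ψ_Δ`, that is `∀ x (δ(x) → ∃ y φ_Δ(x, y))`. -/
noncomputable def extensionAxiom {L : FirstOrder.Language.{u, v}} {n m : ℕ}
    (Δ : Finset (FlatLiteral L (Fin n ⊕ Fin m))) : L.Sentence :=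
  FirstOrder.Language.Formula.iAlls (α := Empty) (Fin n)
    (((nonredundant L (Fin n)).imp
      (FirstOrder.Language.Formula.iExs (Fin m) (diagramFormula Δ))).relabel Sum.inr)

/-- The theory `T^∅_L` of the generic `L`-structure (the model companion of the empty
`L`-theory). -/
def genericTheory (L : FirstOrder.Language.{u, v}) : L.Theory :=
  {ψ | ∃ (n m : ℕ) (Δ : Finset (FlatLiteral L (Fin n ⊕ Fin m))),
    IsExtensionDiagram Δ ∧ ψ = extensionAxiom Δ}

/-! ### Types, algebraic closure and monster models -/

section Types

variable (L : FirstOrder.Language.{u, v}) {M : Type w} [L.Structure M]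

/-- The complete type `tp(a / B)` of a (possibly infinite) tuple `a`, as a set of formulas in the
variables `α` with parameters from `B`. -/
def tp {α : Type*} (B : Set M) (a : α → M) : Set (L.Formula (α ⊕ B)) :=
  {φ | φ.Realize (Sum.elim a (fun b : B => (b : M)))}

/-- `A' ≡_B A` for sets: for some enumeration of `A'` by `A`, the two enumerations have the same
type over `B`. -/
def SetEquivOver (B A' A : Set M) : Prop :=
  ∃ f : A → M, Set.range f = A' ∧ tp L B f = tp L B (fun a : A => (a : M))

/-- The model-theoretic algebraic closure: `acl(A)` is the union of the finite `A`-definable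
sets. -/
def acl (A : Set M) : Set M :=
  {c | ∃ s : Set M, A.Definable₁ L s ∧ s.Finite ∧ c ∈ s}

variable (M)

/-- `κ`-saturation: a set of formulas in one variable, with parameters from a set of cardinality
less than `κ`, that is finitely satisfiable in `M` is realized in `M`. -/
def IsSaturated (κ : Cardinal.{w}) : Prop :=
  ∀ A : Set M, Cardinal.mk A < κ → ∀ p : Set (L.Formula (Unit ⊕ A)),
    (∀ s : Finset (L.Formula (Unit ⊕ A)), (s : Set (L.Formula (Unit ⊕ A))) ⊆ p →
      ∃ c : M, ∀ φ ∈ s, φ.Realize (Sum.elim (fun _ => c) (fun a : A => (a : M)))) →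
    ∃ c : M, ∀ φ ∈ p, φ.Realize (Sum.elim (fun _ => c) (fun a : A => (a : M)))

/-- Strong `κ`-homogeneity: a partial elementary self-map of `M` whose domain has cardinality less
than `κ` extends to an automorphism of `M`. -/
def IsStronglyHomogeneous (κ : Cardinal.{w}) : Prop :=
  ∀ (A : Set M) (f : A → M), Cardinal.mk A < κ →
    (∀ φ : L.Formula A, φ.Realize (fun a : A => (a : M)) ↔ φ.Realize f) →
    ∃ σ : M ≃[L] M, ∀ a : A, σ a = f a

/-- `M` is a monster model, where a set is small if its cardinality is less than `κ`: `κ` exceeds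
the cardinality of the set of formulas, and `M` is `κ`-saturated and strongly `κ`-homogeneous. -/
structure IsMonster (κ : Cardinal.{w}) : Prop where
  card_lt : max Cardinal.aleph0 (Cardinal.lift.{w} L.card) < Cardinal.lift.{max u v} κ
  saturated : IsSaturated L M κ
  homogeneous : IsStronglyHomogeneous L M κ

end Types

/-! ### Independence relations

A ternary relation `R A C B` on sets is read "`A` is independent from `B` over `C`". -/

section Independence

variable (L : FirstOrder.Language.{u, v}) {M : Type w} [L.Structure M]

/-- Algebraic independence. -/
def AlgIndep (A C B : Set M) : Prop :=
  acl L (C ∪ A) ∩ acl L (C ∪ B) = acl L C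

/-- `M`-dividing independence. -/
def MIndep (A C B : Set M) : Prop :=
  ∀ C' : Set M, C ⊆ C' → C' ⊆ acl L (B ∪ C) → AlgIndep L A C' B

/-- The relation obtained from `R` by forcing extension. -/
def ForceExtension (κ : Cardinal.{w}) (R : Set M → Set M → Set M → Prop) (A C B : Set M) : Prop :=
  ∀ B' : Set M, Cardinal.mk B' < κ → B ⊆ B' →
    ∃ A' : Set M, SetEquivOver L (B ∪ C) A' A ∧ R A' C B'

/-- Thorn-forking independence: `M`-dividing independence with extension forced. -/
def ThornIndep (κ : Cardinal.{w}) (A C B : Set M) : Prop :=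
  ForceExtension L κ (MIndep L) A C B

variable {L}

/-- The formula `φ(x; b)` divides over `C`: for some `k` there are realizations `bs 0, bs 1, …` of
`tp(b / C)` such that `{φ(x; bs i) | i < ω}` is `k`-inconsistent. -/
def Divides (C : Set M) {α : Type*} {m : ℕ} (φ : L.Formula (α ⊕ Fin m)) (b : Fin m → M) : Prop :=
  ∃ (k : ℕ) (bs : ℕ → Fin m → M), (∀ i, tp L C (bs i) = tp L C b) ∧
    ∀ s : Finset ℕ, s.card = k → ¬ ∃ a : α → M, ∀ i ∈ s, φ.Realize (Sum.elim a (bs i))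

/-- The set `p` of formulas over `B` implies the condition `S` on `α`-tuples: some finite part of
`p` does. -/
def Implies {α : Type*} {B : Set M} (p : Set (L.Formula (α ⊕ B))) (S : Set (α → M)) : Prop :=
  ∃ s : Finset (L.Formula (α ⊕ B)), (s : Set (L.Formula (α ⊕ B))) ⊆ p ∧
    ∀ a : α → M, (∀ θ ∈ s, θ.Realize (Sum.elim a (fun b : B => (b : M)))) → a ∈ S

/-- A partial type divides over `C` if it implies a formula that divides over `C`. -/
def TypeDivides (C : Set M) {α : Type*} {B : Set M} (p : Set (L.Formula (α ⊕ B))) : Prop :=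
  ∃ (m : ℕ) (φ : L.Formula (α ⊕ Fin m)) (b : Fin m → M),
    Divides C φ b ∧ Implies p {a | φ.Realize (Sum.elim a b)}

/-- A partial type forks over `C` if it implies a finite disjunction of formulas that divide
over `C`. -/
def TypeForks (C : Set M) {α : Type*} {B : Set M} (p : Set (L.Formula (α ⊕ B))) : Prop :=
  ∃ (n : ℕ) (m : Fin n → ℕ) (φ : ∀ i, L.Formula (α ⊕ Fin (m i))) (b : ∀ i, Fin (m i) → M),
    (∀ i, Divides C (φ i) (b i)) ∧ Implies p {a | ∃ i, (φ i).Realize (Sum.elim a (b i))}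

variable (L)

/-- Dividing independence: `tp(A / BC)` does not divide over `C`. -/
def DividingIndep (A C B : Set M) : Prop :=
  ¬ TypeDivides C (tp L (B ∪ C) (fun a : A => (a : M)))

/-- Forking independence: `tp(A / BC)` does not fork over `C`. -/
def ForkingIndep (A C B : Set M) : Prop :=
  ¬ TypeForks C (tp L (B ∪ C) (fun a : A => (a : M)))

/-- Extension over arbitrary small sets. -/
def SatisfiesExtension (κ : Cardinal.{w}) (R : Set M → Set M → Set M → Prop) : Prop :=
  ∀ A C B : Set M, Cardinal.mk A < κ → Cardinal.mk C < κ → Cardinal.mk B < κ → R A C B →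
    ∀ B' : Set M, Cardinal.mk B' < κ → B ⊆ B' →
      ∃ A' : Set M, SetEquivOver L (B ∪ C) A' A ∧ R A' C B'

/-- Two relations coincide on small sets. -/
def AgreeOnSmall (κ : Cardinal.{w}) (R R' : Set M → Set M → Set M → Prop) : Prop :=
  ∀ A C B : Set M, Cardinal.mk A < κ → Cardinal.mk C < κ → Cardinal.mk B < κ →
    (R A C B ↔ R' A C B)

end Independence

end GenericStructure

/-! The axioms make the monster model free: every small extension of a small structure embeds into
it over any given copy of the base (`IsMonster.exists_embedding`). Hence quantifiers are eliminated,
embeddings of small substructures extend to automorphisms, and acl(A) is the generated substructure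
⟨A⟩ (`IsMonster.acl_eq`).

The engine is free amalgamation (`IsMonster.exists_amalgam`): finitely many copies of F are glued to
X along copies of D, and to each other along a common part G. No unintended relation is created:
compatible substructures of X and F generate nothing new inside X.

Extension for M-dividing: amalgamate ⟨ABC⟩ with ⟨B'C⟩ over ⟨BC⟩ and let A' be the copy of A. For C'
⊆ ⟨B'C⟩, independence of A from B over C, applied to ⟨C'⟩ ∩ ⟨BC⟩, is exactly the compatibility
needed.

Dividing and M-dividing coincide on small sets. If x ∈ ⟨C'A⟩ ∩ ⟨BC⟩ lies outside ⟨C'⟩, then x =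
t(c', a) for a term t, and the infinitely many conjugates of x over C' make this equation divide.
Conversely, suppose that conjugates of D = ⟨BC⟩ witness dividing. An ultrafilter limit gives a
sequence with the same k-inconsistency, whose members meet pairwise only in a constant part S ⊇ C.
By hypothesis ⟨SA⟩ ∩ D ⊆ ⟨S⟩, so k copies of ⟨ABC⟩ can be amalgamated over these members with ⟨SA⟩
shared. The common copy of A contradicts k-inconsistency.

The statements on thorn-forking and forking follow formally from extension. -/

namespace GenericStructure

open FirstOrder.Language Cardinal

/-! ### Saturation for types in many variables -/

section Saturation

variable {L : FirstOrder.Language.{u, v}} {M : Type w} [L.Structure M]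

/-- A formula depends on finitely many of its variables. -/
theorem exists_finset_realize_congr {γ : Type*} (φ : L.Formula γ) :
    ∃ V : Finset γ, ∀ v v' : γ → M, (∀ x ∈ V, v x = v' x) → (φ.Realize v ↔ φ.Realize v') := by
  classical
  refine ⟨φ.freeVarFinset, fun v v' h => ?_⟩
  have h1 := BoundedFormula.realize_restrictFreeVar (φ := φ) (f := id)
    (v := fun a : φ.freeVarFinset => v a) (xs := (default : Fin 0 → M)) v (fun _ => rfl)
  have h2 := BoundedFormula.realize_restrictFreeVar (φ := φ) (f := id)
    (v := fun a : φ.freeVarFinset => v' a) (xs := (default : Fin 0 → M)) v' (fun _ => rfl)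
  have h3 : (fun a : φ.freeVarFinset => v a) = fun a : φ.freeVarFinset => v' a :=
    funext fun a => h a a.2
  rw [Formula.Realize, Formula.Realize, ← h1, ← h2, h3]

/-- Existential quantification over an arbitrary tuple of variables is first-order. -/
theorem exists_formula_exists [Nonempty M] {α β : Type*} (φ : L.Formula (α ⊕ β)) :
    ∃ ψ : L.Formula β, ∀ v : β → M, ψ.Realize v ↔ ∃ a : α → M, φ.Realize (Sum.elim a v) := by
  classical
  let V := φ.freeVarFinset
  let ρ : V → β ⊕ V := fun x => Sum.casesOn x.1 (fun _ => Sum.inr x) (fun b => Sum.inl b)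
  have key : ∀ (v : β → M) (i : V → M) (a : α → M),
      (∀ x (h : Sum.inl x ∈ V), a x = i ⟨Sum.inl x, h⟩) →
      (Formula.Realize (BoundedFormula.restrictFreeVar φ ρ) (Sum.elim v i) ↔
        φ.Realize (Sum.elim a v)) := by
    intro v i a hai
    have hv : ∀ x : V, Sum.elim v i (ρ x) = Sum.elim a v x.1 := by
      rintro ⟨x | x, hx⟩
      · exact (hai x hx).symm
      · rfl
    let v' : α ⊕ β → M := fun x => Sum.elim a v x
    exact BoundedFormula.realize_restrictFreeVar (φ := φ) (f := ρ) (v := Sum.elim v i)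
      (xs := (default : Fin 0 → M)) v' hv
  refine ⟨Formula.iExs V (BoundedFormula.restrictFreeVar φ ρ), fun v => ?_⟩
  rw [Formula.realize_iExs]
  constructor
  · rintro ⟨i, hi⟩
    refine ⟨fun x => if h : Sum.inl x ∈ V then i ⟨Sum.inl x, h⟩ else Classical.arbitrary M, ?_⟩
    refine (key v i _ fun x h => ?_).1 hi
    simp [h]
  · rintro ⟨a, ha⟩
    exact ⟨fun x => Sum.elim a v x.1, (key v _ a fun x h => rfl).2 ha⟩

/-- A `κ`-saturated structure realizes finitely satisfiable types in fewer than `κ` variables. -/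
theorem IsSaturated.exists_realize [Nonempty M] {κ : Cardinal.{w}} (hκ : ℵ₀ ≤ κ)
    (hM : IsSaturated L M κ) {α : Type w} (hα : #α < κ) {W : Set M} (hW : #W < κ)
    (q : Set (L.Formula (α ⊕ W)))
    (hq : ∀ s : Finset (L.Formula (α ⊕ W)), (s : Set (L.Formula (α ⊕ W))) ⊆ q →
      ∃ a : α → M, ∀ φ ∈ s, φ.Realize (Sum.elim a (fun b : W => (b : M)))) :
    ∃ a : α → M, ∀ φ ∈ q, φ.Realize (Sum.elim a (fun b : W => (b : M))) := by
  classical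
  -- Zorn's lemma is applied to graphs of partial assignments that stay finitely consistent with
  -- `q`; one-variable saturation makes a maximal one total.
  let good : Set (α × M) → Prop := fun r => ∀ s : Finset (L.Formula (α ⊕ W)),
    (s : Set (L.Formula (α ⊕ W))) ⊆ q → ∀ r₀ : Finset (α × M), (r₀ : Set (α × M)) ⊆ r →
      ∃ a : α → M, (∀ p ∈ r₀, a p.1 = p.2) ∧
        ∀ φ ∈ s, φ.Realize (Sum.elim a (fun b : W => (b : M)))
  obtain ⟨r, hr⟩ : ∃ r, Maximal (· ∈ {r | good r}) r := by
    refine zorn_subset _ fun c hc hchain => ?_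
    rcases c.eq_empty_or_nonempty with rfl | hne
    · refine ⟨∅, fun s hs r₀ hr₀ => ?_, by simp⟩
      obtain ⟨a, ha⟩ := hq s hs
      refine ⟨a, fun p hp => (hr₀ hp).elim, ha⟩
    · refine ⟨⋃₀ c, fun s hs r₀ hr₀ => ?_, fun t ht => Set.subset_sUnion_of_mem ht⟩
      obtain ⟨t, ht, hrt⟩ := DirectedOn.exists_mem_subset_of_finset_subset_biUnion
        (f := id) hne (hchain.directedOn) (s := r₀) (by simpa [Set.sUnion_eq_biUnion] using hr₀)
      exact hc ht s hs r₀ hrt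
  have hfun : ∀ {x c c'}, (x, c) ∈ r → (x, c') ∈ r → c = c' := by
    intro x c c' h h'
    obtain ⟨a, ha, -⟩ := hr.1 ∅ (by simp) {(x, c), (x, c')} (by
      intro p hp
      simp only [Finset.coe_insert, Finset.coe_singleton, Set.mem_insert_iff,
        Set.mem_singleton_iff] at hp
      rcases hp with rfl | rfl <;> assumption)
    have h1 := ha (x, c) (by simp)
    have h2 := ha (x, c') (by simp)
    exact h1.symm.trans h2
  let P : Set M := W ∪ Prod.snd '' r
  have hrα : #r ≤ #α := by
    refine Cardinal.mk_le_of_injective (f := fun p : r => p.1.1) ?_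
    rintro ⟨⟨x, c⟩, h⟩ ⟨⟨x', c'⟩, h'⟩ hx
    obtain rfl : x = x' := hx
    rw [Subtype.mk.injEq, hfun h h']
  have hP : #P < κ := (Cardinal.mk_union_le _ _).trans_lt
    (Cardinal.add_lt_of_lt hκ hW ((Cardinal.mk_image_le.trans hrα).trans_lt hα))
  have htot : ∀ x, ∃ c, (x, c) ∈ r := by
    intro x
    let jW : W → P := fun b => ⟨b, Or.inl b.2⟩
    let S := {p : Finset (L.Formula (α ⊕ W)) × Finset (α × M) //
      (p.1 : Set (L.Formula (α ⊕ W))) ⊆ q ∧ (p.2 : Set (α × M)) ⊆ r}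
    have hχ : ∀ p : S, ∃ χ : L.Formula (Unit ⊕ P), ∀ z : M,
        χ.Realize (Sum.elim (fun _ => z) (fun b : P => (b : M))) ↔
          ∃ a : α → M, a x = z ∧ (∀ y ∈ p.1.2, a y.1 = y.2) ∧
            ∀ φ ∈ p.1.1, φ.Realize (Sum.elim a (fun b : W => (b : M))) := by
      intro p
      let θ₁ : L.Formula (α ⊕ (Unit ⊕ P)) := Term.equal (Term.var (Sum.inl x))
        (Term.var (Sum.inr (Sum.inl ())))
      let θ₂ : L.Formula (α ⊕ (Unit ⊕ P)) := Formula.iInf fun y : {y // y ∈ p.1.2} =>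
        Term.equal (Term.var (Sum.inl y.1.1))
          (Term.var (Sum.inr (Sum.inr ⟨y.1.2, Or.inr ⟨y.1, p.2.2 y.2, rfl⟩⟩)))
      let θ₃ : L.Formula (α ⊕ (Unit ⊕ P)) := Formula.iInf fun φ : {φ // φ ∈ p.1.1} =>
        φ.1.relabel (Sum.map id (fun b => Sum.inr (jW b)))
      obtain ⟨χ, hχ⟩ := exists_formula_exists (M := M) (θ₁ ⊓ (θ₂ ⊓ θ₃))
      refine ⟨χ, fun z => (hχ _).trans (exists_congr fun a => ?_)⟩
      rw [Formula.realize_inf, Formula.realize_inf]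
      refine and_congr ?_ (and_congr ?_ ?_)
      · simp [θ₁, Formula.realize_equal]
      · simp [θ₂, Formula.realize_equal]
      · simp only [θ₃, Formula.realize_iInf, Formula.realize_relabel, Subtype.forall]
        refine forall₂_congr fun φ _ => ?_
        rw [show (Sum.elim a (Sum.elim (fun _ => z) fun b : P => (b : M))) ∘
          Sum.map id (fun b => Sum.inr (jW b)) = Sum.elim a (fun b : W => (b : M)) from by
            funext t; rcases t with t | t <;> rfl]
    choose χ hχ using hχ
    obtain ⟨c, hc⟩ := hM P hP (Set.range χ) (by
      intro s hs
      rw [Set.subset_range_iff_exists_image_eq] at hs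
      obtain ⟨t, ht⟩ := hs
      have htf : ∃ t' : Finset S, ∀ φ ∈ s, ∃ p ∈ t', χ p = φ := by
        have hsr : ∀ φ ∈ s, ∃ p, χ p = φ := fun φ hφ => by
          have : φ ∈ χ '' t := ht ▸ hφ
          obtain ⟨p, -, hp⟩ := this
          exact ⟨p, hp⟩
        choose g hg using hsr
        exact ⟨s.attach.image fun φ => g φ.1 φ.2, fun φ hφ =>
          ⟨_, Finset.mem_image.2 ⟨⟨φ, hφ⟩, Finset.mem_attach _ _, rfl⟩, hg φ hφ⟩⟩
      obtain ⟨t', ht'⟩ := htf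
      obtain ⟨a, ha₁, ha₂⟩ := hr.1 (t'.biUnion fun p => p.1.1)
        (by
          intro φ hφ
          obtain ⟨p, -, hp⟩ := Finset.mem_biUnion.1 hφ
          exact p.2.1 hp)
        (t'.biUnion fun p => p.1.2)
        (by
          intro φ hφ
          obtain ⟨p, -, hp⟩ := Finset.mem_biUnion.1 hφ
          exact p.2.2 hp)
      refine ⟨a x, fun φ hφ => ?_⟩
      obtain ⟨p, hp, rfl⟩ := ht' φ hφ
      exact (hχ p (a x)).2 ⟨a, rfl, fun y hy => ha₁ y (Finset.mem_biUnion.2 ⟨p, hp, hy⟩),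
        fun φ hφ => ha₂ φ (Finset.mem_biUnion.2 ⟨p, hp, hφ⟩)⟩)
    refine ⟨c, ?_⟩
    have hgood : good (insert (x, c) r) := by
      intro s hs r₀ hr₀
      have hr₁ : ((r₀.erase (x, c) : Finset (α × M)) : Set (α × M)) ⊆ r := by
        intro p hp
        obtain ⟨hne, hp⟩ := Finset.mem_erase.1 hp
        exact (hr₀ hp).resolve_left hne
      obtain ⟨a, hax, ha₁, ha₂⟩ := (hχ ⟨(s, r₀.erase (x, c)), hs, hr₁⟩ c).1 (hc _ ⟨_, rfl⟩)
      refine ⟨a, fun p hp => ?_, ha₂⟩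
      by_cases h : p = (x, c)
      · subst h; exact hax
      · exact ha₁ p (Finset.mem_erase.2 ⟨h, hp⟩)
    exact hr.2 hgood (Set.subset_insert _ _) (Set.mem_insert _ _)
  choose a ha using htot
  refine ⟨a, fun φ hφ => ?_⟩
  -- Consistency is known only for finite parts of the graph, which suffices since `φ` sees finitely
  -- many variables.
  obtain ⟨V, hV⟩ := exists_finset_realize_congr (M := M) φ
  have hfin : {p : α × M | p.2 = a p.1 ∧ Sum.inl p.1 ∈ V}.Finite := by
    refine ((V.finite_toSet.preimage Sum.inl_injective.injOn).image
      (fun x => (x, a x))).subset ?_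
    rintro ⟨x, c⟩ ⟨h1, h2⟩
    exact ⟨x, h2, by simp only at h1; rw [h1]⟩
  obtain ⟨a', ha'₁, ha'₂⟩ := hr.1 {φ} (by simpa using hφ) hfin.toFinset (by
    rintro ⟨x, c⟩ hp
    obtain ⟨h1, -⟩ : c = a x ∧ _ := by simpa using hp
    exact h1 ▸ ha x)
  refine (hV _ _ fun x hx => ?_).1 (ha'₂ φ (by simp))
  rcases x with x | x
  · exact ha'₁ (x, a x) (by simpa using hx)
  · rfl

end Saturation

/-! ### Finite consequences of the extension axioms -/

section Generic

variable {L : FirstOrder.Language.{u, v}} {M : Type w} [L.Structure M]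

theorem realize_nonredundant {W : Type} [Finite W] {v : W → M} :
    (nonredundant L W).Realize v ↔ Function.Injective v := by
  simp only [nonredundant, Formula.realize_iInf, Formula.realize_not, Formula.realize_equal,
    Term.realize_var, Subtype.forall, Prod.forall]
  exact ⟨fun h a b hab => by_contra fun hne => h a b hne hab, fun h a b hne hab => hne (h hab)⟩

theorem exists_realize_diagram (hT : M ⊨ genericTheory L) {n m : ℕ}
    {Δ : Finset (FlatLiteral L (Fin n ⊕ Fin m))} (hΔ : IsExtensionDiagram Δ) {x : Fin n → M}
    (hx : Function.Injective x) :
    ∃ y : Fin m → M, Function.Injective (Sum.elim x y) ∧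
      ∀ ψ ∈ Δ, ψ.toFormula.Realize (Sum.elim x y) := by
  have h := hT.realize_of_mem _ (show extensionAxiom Δ ∈ genericTheory L from ⟨n, m, Δ, hΔ, rfl⟩)
  rw [extensionAxiom, Sentence.Realize, Formula.realize_iAlls] at h
  have h' := h x
  rw [Formula.realize_relabel, Formula.realize_imp, realize_nonredundant,
    Formula.realize_iExs] at h'
  obtain ⟨y, hy⟩ := h' hx
  rw [diagramFormula, Formula.realize_inf, realize_nonredundant, Formula.realize_iInf] at hy
  exact ⟨y, hy.2, fun ψ hψ => hy.1 ⟨ψ, hψ⟩⟩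

theorem FlatLiteral.realize_rel {W : Type} {k : ℕ} {R : L.Relations k} {z : Fin k → W}
    {v : W → M} : (FlatLiteral.rel R z).toFormula.Realize v ↔ Structure.RelMap R (v ∘ z) := by
  rw [FlatLiteral.toFormula, Formula.realize_rel]; rfl

theorem FlatLiteral.realize_notRel {W : Type} {k : ℕ} {R : L.Relations k} {z : Fin k → W}
    {v : W → M} : (FlatLiteral.notRel R z).toFormula.Realize v ↔ ¬ Structure.RelMap R (v ∘ z) := by
  rw [FlatLiteral.toFormula, Formula.realize_not, Formula.realize_rel]; rfl

theorem FlatLiteral.realize_func {W : Type} {k : ℕ} {f : L.Functions k} {z : Fin k → W} {z' : W}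
    {v : W → M} : (FlatLiteral.func f z z').toFormula.Realize v ↔
      Structure.funMap f (v ∘ z) = v z' := by
  rw [FlatLiteral.toFormula, Formula.realize_equal]; rfl

theorem nonempty_of_models_genericTheory (hT : M ⊨ genericTheory L) : Nonempty M := by
  obtain ⟨y, -⟩ := exists_realize_diagram hT (n := 0) (m := 1) (Δ := ∅)
    ⟨⟨by simp, by simp⟩, by simp⟩ (x := Fin.elim0) (fun a => a.elim0)
  exact ⟨y 0⟩

/-- Finite pieces of an extension of structures can be realized in a generic structure over a
given copy of the smaller structure. -/
theorem exists_finite_extension (hT : M ⊨ genericTheory L) {X Y : Type*} [L.Structure X]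
    [L.Structure Y] (i : X ↪[L] Y) (g : X ↪[L] M) (V : Finset Y)
    (Fs : Finset (Σ k, L.Functions k × (Fin k → Y)))
    (Rs : Finset (Σ k, L.Relations k × (Fin k → Y))) :
    ∃ v : Y → M, Set.InjOn v V ∧ (∀ x, i x ∈ V → v (i x) = g x) ∧
      (∀ p ∈ Fs, v (Structure.funMap p.2.1 p.2.2) = Structure.funMap p.2.1 (v ∘ p.2.2)) ∧
      ∀ p ∈ Rs, (Structure.RelMap p.2.1 (v ∘ p.2.2) ↔ Structure.RelMap p.2.1 p.2.2) := by
  classical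
  -- All arguments and values in play are included, so that each requirement becomes a flat literal.
  let V' : Finset Y := V ∪ (Fs.biUnion fun p => insert (Structure.funMap p.2.1 p.2.2)
    (Finset.univ.image p.2.2)) ∪ Rs.biUnion fun p => Finset.univ.image p.2.2
  have hFV : ∀ p ∈ Fs, Structure.funMap p.2.1 p.2.2 ∈ V' ∧ ∀ j, p.2.2 j ∈ V' := by
    intro p hp
    have : insert (Structure.funMap p.2.1 p.2.2) (Finset.univ.image p.2.2) ⊆ V' := fun y hy =>
      Finset.mem_union_left _ (Finset.mem_union_right _ (Finset.mem_biUnion.2 ⟨p, hp, hy⟩))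
    exact ⟨this (Finset.mem_insert_self _ _), fun j => this (Finset.mem_insert_of_mem
      (Finset.mem_image_of_mem _ (Finset.mem_univ j)))⟩
  have hRV : ∀ p ∈ Rs, ∀ j, p.2.2 j ∈ V' := fun p hp j =>
    Finset.mem_union_right _ (Finset.mem_biUnion.2
      ⟨p, hp, Finset.mem_image_of_mem _ (Finset.mem_univ j)⟩)
  let VX := V'.filter (· ∈ Set.range i)
  let VY := V'.filter (· ∉ Set.range i)
  let eX := VX.equivFin
  let eY := VY.equivFin
  have hVX : ∀ {y}, y ∈ VX ↔ y ∈ V' ∧ y ∈ Set.range i := fun {y} => Finset.mem_filter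
  have hVY : ∀ {y}, y ∈ VY ↔ y ∈ V' ∧ y ∉ Set.range i := fun {y} => Finset.mem_filter
  let W := Fin VX.card ⊕ Fin VY.card
  let ι : W → Y := Sum.elim (fun a => (eX.symm a : Y)) (fun a => (eY.symm a : Y))
  have hιinj : Function.Injective ι := by
    rintro (a | a) (b | b) hab
    · exact congrArg Sum.inl (eX.symm.injective (Subtype.ext hab))
    · refine ((hVY.1 (eY.symm b).2).2 ?_).elim
      rw [← show ι (.inl a) = (eY.symm b : Y) from hab]
      exact (hVX.1 (eX.symm a).2).2
    · refine ((hVY.1 (eY.symm a).2).2 ?_).elim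
      rw [show (eY.symm a : Y) = ι (.inl b) from hab]
      exact (hVX.1 (eX.symm b).2).2
    · exact congrArg Sum.inr (eY.symm.injective (Subtype.ext hab))
  have hιsurj : ∀ y ∈ V', ∃ a, ι a = y := by
    intro y hy
    by_cases h : y ∈ Set.range i
    · exact ⟨Sum.inl (eX ⟨y, hVX.2 ⟨hy, h⟩⟩), by simp [ι]⟩
    · exact ⟨Sum.inr (eY ⟨y, hVY.2 ⟨hy, h⟩⟩), by simp [ι]⟩
  have hιimg : ∀ a, ι a ∈ V' := by
    rintro (a | a)
    exacts [(hVX.1 (eX.symm a).2).1, (hVY.1 (eY.symm a).2).1]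
  have hιr : ∀ b, ι (Sum.inr b) ∉ Set.range i := fun b => (hVY.1 (eY.symm b).2).2
  have hιl : ∀ a, ∃ x, i x = ι (Sum.inl a) := fun a => (hVX.1 (eX.symm a).2).2
  choose x₀ hx₀ using hιl
  choose zF hzF using fun (p : Σ k, L.Functions k × (Fin k → Y)) (hp : p ∈ Fs) =>
    (show ∃ z : Fin p.1 → W, ∀ j, ι (z j) = p.2.2 j from
      ⟨_, fun j => (hιsurj _ ((hFV p hp).2 j)).choose_spec⟩)
  choose wF hwF using fun (p : Σ k, L.Functions k × (Fin k → Y)) (hp : p ∈ Fs) =>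
    hιsurj _ (hFV p hp).1
  choose zR hzR using fun (p : Σ k, L.Relations k × (Fin k → Y)) (hp : p ∈ Rs) =>
    (show ∃ z : Fin p.1 → W, ∀ j, ι (z j) = p.2.2 j from
      ⟨_, fun j => (hιsurj _ (hRV p hp j)).choose_spec⟩)
  let ΔF : Finset (FlatLiteral L W) := Fs.attach.image fun p =>
    FlatLiteral.func p.1.2.1 (zF p.1 p.2) (wF p.1 p.2)
  let ΔR : Finset (FlatLiteral L W) := Rs.attach.image fun p =>
    if Structure.RelMap p.1.2.1 p.1.2.2 then FlatLiteral.rel p.1.2.1 (zR p.1 p.2)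
    else FlatLiteral.notRel p.1.2.1 (zR p.1 p.2)
  -- Literals with no argument among the new points are dropped: they hold automatically, because
  -- `i` and `g` are embeddings. This includes all constants. The remaining ones are consistent
  -- because the injective tuple `ι` satisfies them in `Y`.
  let Δ := (ΔF ∪ ΔR).filter fun ψ => ψ.Meets (Set.range Sum.inr)
  have htrue : ∀ ψ ∈ ΔF ∪ ΔR, ψ.toFormula.Realize ι := by
    intro ψ hψ
    rcases Finset.mem_union.1 hψ with h | h
    · obtain ⟨p, -, rfl⟩ := Finset.mem_image.1 h
      rw [FlatLiteral.realize_func, hwF, show ι ∘ zF p.1 p.2 = p.1.2.2 from funext (hzF p.1 p.2)]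
    · obtain ⟨p, -, rfl⟩ := Finset.mem_image.1 h
      split_ifs with hp
      · rwa [FlatLiteral.realize_rel, show ι ∘ zR p.1 p.2 = p.1.2.2 from funext (hzR p.1 p.2)]
      · rwa [FlatLiteral.realize_notRel, show ι ∘ zR p.1 p.2 = p.1.2.2 from funext (hzR p.1 p.2)]
  have hΔ : IsExtensionDiagram Δ := by
    have hsub : ∀ ψ ∈ Δ, ψ.toFormula.Realize ι := fun ψ hψ => htrue ψ (Finset.mem_filter.1 hψ).1
    refine ⟨⟨fun k R z h => ?_, fun k f z z₁ z₂ h₁ h₂ => hιinj ?_⟩,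
      fun ψ hψ => (Finset.mem_filter.1 hψ).2⟩
    · exact FlatLiteral.realize_notRel.1 (hsub _ h.2) (FlatLiteral.realize_rel.1 (hsub _ h.1))
    · exact (FlatLiteral.realize_func.1 (hsub _ h₁)).symm.trans
        (FlatLiteral.realize_func.1 (hsub _ h₂))
  obtain ⟨y, hy, hyΔ⟩ := exists_realize_diagram hT hΔ (x := fun a => g (x₀ a)) (by
    intro a b hab
    have := congrArg i (g.injective hab)
    rw [hx₀, hx₀] at this
    exact Sum.inl_injective (hιinj this))
  have := nonempty_of_models_genericTheory hT
  set e : W → M := Sum.elim (fun a => g (x₀ a)) y with he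
  let v : Y → M := fun y => if h : ∃ a, ι a = y then e h.choose else Classical.arbitrary M
  have hv : ∀ a, v (ι a) = e a := by
    intro a
    have h : ∃ b, ι b = ι a := ⟨a, rfl⟩
    simp only [v, dif_pos h]
    exact congrArg e (hιinj h.choose_spec)
  have hvι : ∀ {k} (z : Fin k → W), v ∘ ι ∘ z = e ∘ z := fun z => funext fun j => hv (z j)
  have hvg : ∀ x, i x ∈ V' → v (i x) = g x := by
    intro x hx
    obtain ⟨a | a, ha⟩ := hιsurj _ hx
    · rw [← ha, hv]
      exact congrArg g (i.injective ((hx₀ a).trans ha))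
    · exact (hιr a ⟨x, ha.symm⟩).elim
  have hold : ∀ {k} (z : Fin k → W), (¬ ∃ j, z j ∈ Set.range Sum.inr) →
      ∃ z' : Fin k → X, i ∘ z' = ι ∘ z ∧ g ∘ z' = e ∘ z := by
    intro k z hz
    have : ∀ j, ∃ a, z j = Sum.inl a := by
      intro j
      rcases h : z j with a | b
      · exact ⟨a, rfl⟩
      · exact (hz ⟨j, b, h.symm⟩).elim
    choose a ha using this
    refine ⟨fun j => x₀ (a j), funext fun j => ?_, funext fun j => ?_⟩
    · simp only [Function.comp_apply, ha, hx₀]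
    · simp only [Function.comp_apply, ha, he, Sum.elim_inl]
  refine ⟨v, ?_, fun x hx => hvg x (Finset.mem_union_left _ (Finset.mem_union_left _ hx)), ?_, ?_⟩
  · intro y₁ h₁ y₂ h₂ h
    obtain ⟨a₁, rfl⟩ := hιsurj y₁ (Finset.mem_union_left _ (Finset.mem_union_left _ h₁))
    obtain ⟨a₂, rfl⟩ := hιsurj y₂ (Finset.mem_union_left _ (Finset.mem_union_left _ h₂))
    rw [hv, hv] at h
    rw [hy h]
  · intro p hp
    have hz : ι ∘ zF p hp = p.2.2 := funext (hzF p hp)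
    rw [← hz, hvι]
    by_cases hm : ∃ j, zF p hp j ∈ Set.range Sum.inr
    · have := hyΔ (FlatLiteral.func p.2.1 (zF p hp) (wF p hp)) (Finset.mem_filter.2
        ⟨Finset.mem_union_left _ (Finset.mem_image.2 ⟨⟨p, hp⟩, Finset.mem_attach _ _, rfl⟩), hm⟩)
      rw [FlatLiteral.realize_func] at this
      rw [this, ← hv, hwF, hz]
    · obtain ⟨z', h₁, h₂⟩ := hold _ hm
      rw [← h₁, ← h₂, ← i.map_fun, ← g.map_fun, hvg]
      rw [i.map_fun, h₁, hz]
      exact (hFV p hp).1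
  · intro p hp
    have hz : ι ∘ zR p hp = p.2.2 := funext (hzR p hp)
    rw [← hz, hvι]
    by_cases hm : ∃ j, zR p hp j ∈ Set.range Sum.inr
    · have := hyΔ (if Structure.RelMap p.2.1 p.2.2 then FlatLiteral.rel p.2.1 (zR p hp)
        else FlatLiteral.notRel p.2.1 (zR p hp)) (Finset.mem_filter.2
        ⟨Finset.mem_union_right _ (Finset.mem_image.2 ⟨⟨p, hp⟩, Finset.mem_attach _ _, rfl⟩), by
          split_ifs <;> exact hm⟩)
      split_ifs at this with hR
      · rw [FlatLiteral.realize_rel] at this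
        rw [hz]
        exact iff_of_true this hR
      · rw [FlatLiteral.realize_notRel] at this
        rw [hz]
        exact iff_of_false this hR
    · obtain ⟨z', h₁, h₂⟩ := hold _ hm
      rw [← h₁, ← h₂, i.map_rel, g.map_rel]

end Generic

/-! ### Universality, quantifier elimination and conjugacy -/

section Monster

variable {L : FirstOrder.Language.{u, v}} {M : Type w} [L.Structure M] {κ : Cardinal.{w}}

theorem IsMonster.aleph0_lt (hM : IsMonster L M κ) : ℵ₀ < κ := by
  have h := (le_max_left _ _).trans_lt hM.card_lt
  simpa using h

theorem IsMonster.mk_closure_lt (hM : IsMonster L M κ) {s : Set M} (hs : #s < κ) :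
    #(Substructure.closure L s) < κ := by
  have h1 : Cardinal.lift.{max v w} #(Σ i, L.Functions i) < Cardinal.lift.{max u v} κ := by
    refine lt_of_le_of_lt ?_ ((le_max_right _ _).trans_lt hM.card_lt)
    rw [Language.card, Language.Symbols, Cardinal.mk_sum, Cardinal.lift_add, Cardinal.lift_lift]
    exact self_le_add_right _ _
  have h2 := Cardinal.lift_le.{v}.2 (Substructure.lift_card_closure_le (L := L) (s := s))
  rw [Cardinal.lift_max, Cardinal.lift_add, Cardinal.lift_lift, Cardinal.lift_lift,
    Cardinal.lift_lift, Cardinal.lift_aleph0] at h2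
  have h3 : Cardinal.lift.{max u v} #(Substructure.closure L s) < Cardinal.lift.{max u v} κ := by
    have hκ : ℵ₀ < Cardinal.lift.{max u v} κ := by simpa using hM.aleph0_lt
    exact h2.trans_lt (max_lt hκ (Cardinal.add_lt_of_lt hκ.le (Cardinal.lift_lt.2 hs) h1))
  exact Cardinal.lift_lt.1 h3

theorem mk_union_lt (hκ : ℵ₀ ≤ κ) {s t : Set M} (hs : #s < κ) (ht : #t < κ) :
    #(s ∪ t : Set M) < κ :=
  (Cardinal.mk_union_le _ _).trans_lt (Cardinal.add_lt_of_lt hκ hs ht)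

/-- Small extensions of structures embed into the monster model over any copy of the base. -/
theorem IsMonster.exists_embedding (hM : IsMonster L M κ) (hT : M ⊨ genericTheory L)
    {X Y : Type w} [L.Structure X] [L.Structure Y] (hY : #Y < κ) (i : X ↪[L] Y) (g : X ↪[L] M) :
    ∃ h : Y ↪[L] M, ∀ x, h (i x) = g x := by
  classical
  have := nonempty_of_models_genericTheory hT
  let W : Set M := Set.range g
  have hW : #W < κ := Cardinal.mk_range_le.trans_lt
    ((Cardinal.mk_le_of_injective i.injective).trans_lt hY)
  let good : Finset Y → Finset (Σ k, L.Functions k × (Fin k → Y)) →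
      Finset (Σ k, L.Relations k × (Fin k → Y)) → (Y → M) → Prop := fun V Fs Rs v =>
    Set.InjOn v V ∧ (∀ x, i x ∈ V → v (i x) = g x) ∧
      (∀ p ∈ Fs, v (Structure.funMap p.2.1 p.2.2) = Structure.funMap p.2.1 (v ∘ p.2.2)) ∧
      ∀ p ∈ Rs, (Structure.RelMap p.2.1 (v ∘ p.2.2) ↔ Structure.RelMap p.2.1 p.2.2)
  obtain ⟨h, hh⟩ := hM.saturated.exists_realize hM.aleph0_lt.le hY hW
    -- The type consists of everything implied by finitely many embedding conditions. Finite
    -- satisfiability follows by pooling these conditions; each clause of being an embedding over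
    -- `g` is then read off from a single condition.
    {φ | ∃ V Fs Rs, ∀ v, good V Fs Rs v → φ.Realize (Sum.elim v (fun b : W => (b : M)))} (by
      intro s hs
      choose V Fs Rs hφ using hs
      obtain ⟨v, hv₁, hv₂, hv₃, hv₄⟩ := exists_finite_extension hT i g
        (s.attach.biUnion fun φ => V φ.2) (s.attach.biUnion fun φ => Fs φ.2)
        (s.attach.biUnion fun φ => Rs φ.2)
      refine ⟨v, fun φ h => hφ h v ⟨hv₁.mono ?_, fun x hx => hv₂ x ?_, fun p hp => hv₃ p ?_,
        fun p hp => hv₄ p ?_⟩⟩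
      · exact Finset.coe_subset.2
          (Finset.subset_biUnion_of_mem (fun φ : s => V φ.2) (Finset.mem_attach s ⟨φ, h⟩))
      all_goals exact Finset.mem_biUnion.2 ⟨⟨φ, h⟩, Finset.mem_attach _ _, by assumption⟩)
  refine ⟨⟨⟨h, fun y y' hyy => ?_⟩, fun {k} f z => ?_, fun {k} R z => ?_⟩, fun x => ?_⟩
  · by_contra hne
    have := hh (∼(Term.equal (Term.var (Sum.inl y)) (Term.var (Sum.inl y'))))
      ⟨{y, y'}, ∅, ∅, fun v hv => by
        rw [Formula.realize_not, Formula.realize_equal]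
        exact fun h => hne (hv.1 (by simp) (by simp) h)⟩
    rw [Formula.realize_not, Formula.realize_equal] at this
    exact this hyy
  · have := hh (Term.equal (Term.func f fun j => Term.var (Sum.inl (z j)))
      (Term.var (Sum.inl (Structure.funMap f z)))) ⟨∅, {⟨k, f, z⟩}, ∅, fun v hv => by
        rw [Formula.realize_equal]
        exact (hv.2.2.1 ⟨k, f, z⟩ (by simp)).symm⟩
    rw [Formula.realize_equal] at this
    exact this.symm
  · have key : ∀ v : Y → M, (R.formula fun j => Term.var (L := L) (Sum.inl (β := W) (z j))).Realize
        (Sum.elim v (fun b : W => (b : M))) ↔ Structure.RelMap R (v ∘ z) := fun v => by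
      rw [Formula.realize_rel]; rfl
    change Structure.RelMap R (h ∘ z) ↔ _
    rw [← key]
    by_cases hR : Structure.RelMap R z
    · refine iff_of_true (hh _ ⟨∅, ∅, {⟨k, R, z⟩}, fun v hv => ?_⟩) hR
      rw [key]
      exact (hv.2.2.2 ⟨k, R, z⟩ (by simp)).2 hR
    · refine iff_of_false ?_ hR
      rw [← Formula.realize_not]
      refine hh _ ⟨∅, ∅, {⟨k, R, z⟩}, fun v hv => ?_⟩
      rw [Formula.realize_not, key]
      exact fun h => hR ((hv.2.2.2 ⟨k, R, z⟩ (by simp)).1 h)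
  · have := hh (Term.equal (Term.var (Sum.inl (i x))) (Term.var (Sum.inr ⟨g x, x, rfl⟩)))
      ⟨{i x}, ∅, ∅, fun v hv => by
        rw [Formula.realize_equal]
        exact hv.2.1 x (by simp)⟩
    rw [Formula.realize_equal] at this
    exact this

/-- The extension step of the back-and-forth: a point added on the side of `f` is matched on the
side of `g`. -/
theorem IsMonster.exists_embedding_substructure (hM : IsMonster L M κ)
    (hT : M ⊨ genericTheory L) {S : Type w} [L.Structure S] (hS : #S < κ) (f g : S ↪[L] M) (c : M) :
    ∃ (S' : L.Substructure M) (i : S ↪[L] S') (g' : S' ↪[L] M), #S' < κ ∧ c ∈ S' ∧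
      (∀ x, (i x : M) = f x) ∧ ∀ x, g' (i x) = g x := by
  let S' := Substructure.closure L (Set.range f ∪ {c})
  have hf : ∀ x, f x ∈ S' := fun x => Substructure.subset_closure (Or.inl ⟨x, rfl⟩)
  have hS' : #S' < κ := hM.mk_closure_lt (mk_union_lt hM.aleph0_lt.le
    (Cardinal.mk_range_le.trans_lt hS)
    ((Cardinal.mk_singleton c).trans_lt (Cardinal.one_lt_aleph0.trans hM.aleph0_lt)))
  obtain ⟨g', hg'⟩ := hM.exists_embedding hT hS' (f.codRestrict S' hf) g
  exact ⟨S', f.codRestrict S' hf, g', hS', Substructure.subset_closure (Or.inr rfl),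
    fun x => rfl, hg'⟩

/-- Quantifier elimination: any two embeddings of a small structure into the monster model
satisfy the same formulas. -/
theorem IsMonster.realize_embedding (hM : IsMonster L M κ) (hT : M ⊨ genericTheory L)
    {α : Type*} {n : ℕ} (φ : L.BoundedFormula α n) {S : Type w} [L.Structure S] (hS : #S < κ)
    (f g : S ↪[L] M) (a : α → S) (xs : Fin n → S) :
    φ.Realize (f ∘ a) (f ∘ xs) ↔ φ.Realize (g ∘ a) (g ∘ xs) := by
  induction φ generalizing S with
  | falsum => rfl
  | equal t₁ t₂ =>
    have h : (BoundedFormula.equal t₁ t₂).IsQF := (BoundedFormula.IsAtomic.equal t₁ t₂).isQF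
    rw [h.realize_embedding, h.realize_embedding]
  | rel R ts =>
    have h : (BoundedFormula.rel R ts).IsQF := (BoundedFormula.IsAtomic.rel R ts).isQF
    rw [h.realize_embedding, h.realize_embedding]
  | imp φ ψ ih₁ ih₂ => exact imp_congr (ih₁ hS f g a xs) (ih₂ hS f g a xs)
  | @all n φ ih =>
    have step : ∀ f g : S ↪[L] M, φ.all.Realize (g ∘ a) (g ∘ xs) →
        φ.all.Realize (f ∘ a) (f ∘ xs) := by
      intro f g h c
      obtain ⟨S', i, g', hS', hc, hi, hg'⟩ := hM.exists_embedding_substructure hT hS f g c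
      have h1 := (ih hS' S'.subtype g' (i ∘ a) (Fin.snoc (i ∘ xs) ⟨c, hc⟩)).2
      have hia : S'.subtype ∘ i ∘ a = f ∘ a := funext fun j => hi (a j)
      have hix : S'.subtype ∘ i ∘ xs = f ∘ xs := funext fun j => hi (xs j)
      have hga : g' ∘ i ∘ a = g ∘ a := funext fun j => hg' (a j)
      have hgx : g' ∘ i ∘ xs = g ∘ xs := funext fun j => hg' (xs j)
      rw [Fin.comp_snoc, Fin.comp_snoc, hia, hix, hga, hgx] at h1
      exact h1 (h _)
    exact ⟨step g f, step f g⟩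

/-- Tuples of the same type over `∅` are conjugate. -/
theorem IsMonster.exists_equiv_of_realize_iff (hM : IsMonster L M κ) {α : Type*}
    {a a' : α → M} (hα : #(Set.range a) < κ) (h : ∀ φ : L.Formula α, φ.Realize a ↔ φ.Realize a') :
    ∃ σ : M ≃[L] M, ∀ i, σ (a i) = a' i := by
  -- Homogeneity speaks of sets, so each value gets a representative index; equal entries of `a`
  -- correspond to equal entries of `a'`.
  choose s hs using fun x : Set.range a => x.2
  have hinj : ∀ i j, a i = a j → a' i = a' j := by
    intro i j hij
    have := (h (Term.equal (Term.var i) (Term.var j))).1 (by rwa [Formula.realize_equal])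
    rwa [Formula.realize_equal] at this
  obtain ⟨σ, hσ⟩ := hM.homogeneous (Set.range a) (a' ∘ s) hα (by
    intro φ
    have := h (φ.relabel s)
    rwa [Formula.realize_relabel, Formula.realize_relabel,
      show a ∘ s = fun x : Set.range a => (x : M) from funext hs] at this)
  refine ⟨σ, fun i => (hσ ⟨a i, i, rfl⟩).trans (hinj _ _ (hs _))⟩

theorem IsMonster.exists_equiv_of_tp_eq (hM : IsMonster L M κ) {α : Type*}
    {B : Set M} (hB : #B < κ) {a a' : α → M} (hα : #(Set.range a) < κ) (h : tp L B a = tp L B a') :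
    ∃ σ : M ≃[L] M, (∀ b ∈ B, σ b = b) ∧ ∀ i, σ (a i) = a' i := by
  obtain ⟨σ, hσ⟩ := hM.exists_equiv_of_realize_iff (α := α ⊕ B)
    (a := Sum.elim a fun b : B => (b : M)) (a' := Sum.elim a' fun b : B => (b : M))
    (by
      rw [Set.Sum.elim_range, Subtype.range_coe]
      exact mk_union_lt hM.aleph0_lt.le hα hB) (fun φ => Set.ext_iff.1 h φ)
  exact ⟨σ, fun b hb => hσ (Sum.inr ⟨b, hb⟩), fun i => hσ (Sum.inl i)⟩

theorem tp_equiv {α : Type*} {B : Set M} (σ : M ≃[L] M) (hσ : ∀ b ∈ B, σ b = b) (a : α → M) :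
    tp L B (fun i => σ (a i)) = tp L B a := by
  ext φ
  have h : Sum.elim (fun i => σ (a i)) (fun b : B => (b : M)) =
      σ ∘ Sum.elim a (fun b : B => (b : M)) := by
    funext x
    rcases x with x | x
    · rfl
    · exact (hσ x x.2).symm
  change Formula.Realize φ _ ↔ Formula.Realize φ _
  rw [h, StrongHomClass.realize_formula]

/-- Embeddings of small substructures into the monster model extend to automorphisms. -/
theorem IsMonster.exists_equiv_of_embedding (hM : IsMonster L M κ) (hT : M ⊨ genericTheory L)
    {S : L.Substructure M} (hS : #S < κ) (g : S ↪[L] M) :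
    ∃ σ : M ≃[L] M, ∀ x : S, σ x = g x := by
  refine hM.exists_equiv_of_realize_iff (a := fun x : S => (x : M))
    (Cardinal.mk_range_le.trans_lt hS) fun φ => ?_
  have := hM.realize_embedding hT φ hS S.subtype g id default
  rw [Formula.Realize, Formula.Realize]
  convert this using 1 <;> congr! 1

end Monster

/-! ### Free amalgamation -/

section Gluing

variable {L : FirstOrder.Language.{u, v}}

/-- A coherent atlas of injective charts `j i : F i → Z` is induced by a structure on `Z` together
with one more point, which is the value of every function at arguments outside all charts. -/
theorem exists_glue {ι Z : Type*} {F : ι → Type*} [∀ i, L.Structure (F i)] (j : ∀ i, F i → Z)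
    (hj : ∀ i, Function.Injective (j i))
    (hcoh : ∀ i i' {n : ℕ} (w : Fin n → F i) (w' : Fin n → F i'),
      (∀ k, j i (w k) = j i' (w' k)) →
        (∀ f : L.Functions n, j i (Structure.funMap f w) = j i' (Structure.funMap f w')) ∧
        ∀ R : L.Relations n, Structure.RelMap R w → Structure.RelMap R w') :
    ∃ _ : L.Structure (Option Z),
      (∀ i, ∃ e : F i ↪[L] Option Z, ∀ x, e x = some (j i x)) ∧
      ∀ T : Set (Option Z), none ∈ T →
        (∀ i {n : ℕ} (f : L.Functions n) (w : Fin n → F i), (∀ k, some (j i (w k)) ∈ T) →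
          some (j i (Structure.funMap f w)) ∈ T) →
        ∀ {n : ℕ} (f : L.Functions n), ClosedUnder f T := by
  classical
  -- Functions are computed in any chart containing the arguments, coherence making the choice
  -- irrelevant; `none` absorbs all other tuples.
  let str : L.Structure (Option Z) :=
    { funMap := fun {n} f z => if h : ∃ i, ∃ w : Fin n → F i, ∀ k, some (j i (w k)) = z k then
        some (j h.choose (Structure.funMap f h.choose_spec.choose)) else none
      RelMap := fun {n} R z => ∃ i, ∃ w : Fin n → F i, (∀ k, some (j i (w k)) = z k) ∧
        Structure.RelMap R w }
  have hfun : ∀ i {n : ℕ} (f : L.Functions n) (w : Fin n → F i),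
      str.funMap f (fun k => some (j i (w k))) = some (j i (Structure.funMap f w)) := by
    intro i n f w
    have h : ∃ i', ∃ w' : Fin n → F i', ∀ k, some (j i' (w' k)) = some (j i (w k)) :=
      ⟨i, w, fun k => rfl⟩
    have h1 : str.funMap f (fun k => some (j i (w k))) =
      some (j h.choose (Structure.funMap f h.choose_spec.choose)) := dif_pos h
    rw [h1]
    exact congrArg some ((hcoh _ _ _ _ fun k => Option.some_injective _
      (h.choose_spec.choose_spec k)).1 f)
  refine ⟨str, fun i => ⟨⟨⟨fun x => some (j i x), fun x y h => hj i (Option.some_injective _ h)⟩,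
    fun f x => (hfun i f x).symm, fun {n} R x => ⟨?_, fun h => ⟨i, x, fun k => rfl, h⟩⟩⟩,
    fun x => rfl⟩, fun T hT hT' n f z hz => ?_⟩
  · rintro ⟨i', w, hw, hR⟩
    exact (hcoh _ _ w x fun k => Option.some_injective _ (hw k)).2 R hR
  · by_cases h : ∃ i, ∃ w : Fin n → F i, ∀ k, some (j i (w k)) = z k
    · obtain ⟨i, w, hw⟩ := h
      obtain rfl : (fun k => some (j i (w k))) = z := funext hw
      rw [hfun]
      exact hT' i f w hz
    · have h1 : str.funMap f z = none := dif_neg h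
      rw [h1]
      exact hT

variable {M : Type w} [L.Structure M] {κ : Cardinal.{w}}

/-- Free amalgamation inside the monster model: given a small substructure `X` containing copies
`σ i '' D` of `D ≤ F`, the maps `σ i` can be extended to `F`, agreeing on a prescribed substructure
`G` and otherwise as freely as possible. -/
theorem IsMonster.exists_amalgam (hM : IsMonster L M κ) (hT : M ⊨ genericTheory L)
    {ι : Type} [Finite ι] {X F D G : L.Substructure M} (hX : #X < κ) (hF : #F < κ) (hDF : D ≤ F)
    (σ : ι → M ≃[L] M) (hσ : ∀ i, ∀ x ∈ D, σ i x ∈ X)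
    (hdisj : ∀ i i', i ≠ i' → ∀ x ∈ D, ∀ x' ∈ D, σ i x = σ i' x' → x = x' ∧ x ∈ G)
    (hagree : ∀ i i', ∀ x ∈ D, x ∈ G → σ i x = σ i' x) :
    ∃ τ : ι → M ≃[L] M, (∀ i, ∀ x ∈ D, τ i x = σ i x) ∧
      (∀ i i', ∀ x ∈ F, x ∈ G → τ i x = τ i' x) ∧ (∀ i, ∀ x ∈ F, τ i x ∈ X → x ∈ D) ∧
      ∀ TX TF : L.Substructure M, TX ≤ X → TF ≤ F → (∀ i, ∀ x ∈ D, σ i x ∈ TX ↔ x ∈ TF) →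
        ∀ y ∈ X, y ∈ Substructure.closure L ((TX : Set M) ∪ ⋃ i, τ i '' TF) → y ∈ TX := by
  classical
  -- Outside `D`, a point of `G` gets the shared tag `none`, and any other point a private copy
  -- tagged `some i`. Points of `D` go into `X` through `σ i`. Unused points of `Z` are harmless.
  let Z := X ⊕ (Option ι × F)
  have hZ : #(Option Z) < κ := by
    have hκ := hM.aleph0_lt
    have h1 : #(Option ι × F) < κ := by
      rw [Cardinal.mk_prod]
      refine Cardinal.mul_lt_of_lt hκ.le ?_ (by simpa using hF)
      exact (Cardinal.lift_lt_aleph0.2 (Cardinal.lt_aleph0_of_finite _)).trans hκ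
    rw [Cardinal.mk_option, Cardinal.mk_sum, Cardinal.lift_id, Cardinal.lift_id]
    exact Cardinal.add_lt_of_lt hκ.le (Cardinal.add_lt_of_lt hκ.le hX h1)
      (Cardinal.one_lt_aleph0.trans hκ)
  let S : Option ι → L.Substructure M := fun o => o.elim X fun _ => F
  let jF : ι → F → Z := fun i x => if h : (x : M) ∈ D then Sum.inl ⟨σ i x, hσ i x h⟩
    else if (x : M) ∈ G then Sum.inr (none, x) else Sum.inr (some i, x)
  let j : ∀ o, S o → Z := fun o => match o with
    | none => fun x => Sum.inl x
    | some i => jF i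
  have hjD : ∀ i (x : F) (h : (x : M) ∈ D), jF i x = Sum.inl ⟨σ i x, hσ i x h⟩ :=
    fun i x h => dif_pos h
  have hjG : ∀ i (x : F), (x : M) ∉ D → (x : M) ∈ G → jF i x = Sum.inr (none, x) :=
    fun i x h h' => (dif_neg h).trans (if_pos h')
  have hjN : ∀ i (x : F), (x : M) ∉ D → (x : M) ∉ G → jF i x = Sum.inr (some i, x) :=
    fun i x h h' => (dif_neg h).trans (if_neg h')
  have hX_eq : ∀ i (x : F) (y : X), jF i x = Sum.inl y → (x : M) ∈ D ∧ σ i x = y := by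
    intro i x y h
    by_cases hD : (x : M) ∈ D
    · rw [hjD i x hD] at h
      exact ⟨hD, congrArg Subtype.val (Sum.inl_injective h)⟩
    · by_cases hG : (x : M) ∈ G
      · simp [hjG i x hD hG] at h
      · simp [hjN i x hD hG] at h
  have hFF : ∀ i i' (x x' : F), jF i x = jF i' x' → x = x' ∧ (i = i' ∨ (x : M) ∈ G) := by
    intro i i' x x' h
    by_cases hD : (x : M) ∈ D
    · rw [hjD i x hD] at h
      obtain ⟨hD', h'⟩ := hX_eq i' x' _ h.symm
      by_cases hi : i = i'
      · subst hi
        exact ⟨Subtype.ext ((σ i).injective h'.symm), Or.inl rfl⟩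
      · obtain ⟨h1, h2⟩ := hdisj i i' hi x hD x' hD' h'.symm
        exact ⟨Subtype.ext h1, Or.inr h2⟩
    · have hD' : (x' : M) ∉ D := fun hD' => hD (hX_eq i x _ (h.trans (hjD i' x' hD'))).1
      by_cases hG : (x : M) ∈ G <;> by_cases hG' : (x' : M) ∈ G
      · rw [hjG i x hD hG, hjG i' x' hD' hG'] at h
        exact ⟨(Prod.mk.inj (Sum.inr_injective h)).2, Or.inr hG⟩
      · rw [hjG i x hD hG, hjN i' x' hD' hG'] at h
        exact (Option.some_ne_none _ (Prod.mk.inj (Sum.inr_injective h)).1.symm).elim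
      · rw [hjN i x hD hG, hjG i' x' hD' hG'] at h
        exact (Option.some_ne_none _ (Prod.mk.inj (Sum.inr_injective h)).1).elim
      · rw [hjN i x hD hG, hjN i' x' hD' hG'] at h
        obtain ⟨h1, h2⟩ := Prod.mk.inj (Sum.inr_injective h)
        exact ⟨h2, Or.inl (Option.some_injective _ h1)⟩
  have hGG : ∀ i i' (x : F), (x : M) ∈ G → jF i x = jF i' x := by
    intro i i' x hG
    by_cases hD : (x : M) ∈ D
    · rw [hjD i x hD, hjD i' x hD]
      exact congrArg Sum.inl (Subtype.ext (hagree i i' x hD hG))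
    · rw [hjG i x hD hG, hjG i' x hD hG]
  have hcohX : ∀ i {n : ℕ} (w : Fin n → X) (w' : Fin n → F), (∀ k, jF i (w' k) = Sum.inl (w k)) →
      (∀ f : L.Functions n, jF i (Structure.funMap f w') = Sum.inl (Structure.funMap f w)) ∧
        ∀ R : L.Relations n, Structure.RelMap R w ↔ Structure.RelMap R w' := by
    intro i n w w' h
    have hw : ∀ k, (w' k : M) ∈ D ∧ σ i (w' k) = w k := fun k => hX_eq _ _ _ (h k)
    have hwσ : (fun k => (w k : M)) = σ i ∘ fun k => (w' k : M) := funext fun k => (hw k).2.symm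
    refine ⟨fun f => ?_, fun R => ?_⟩
    · have hD : ((Structure.funMap f w' : F) : M) ∈ D := D.fun_mem f _ fun k => (hw k).1
      rw [hjD _ _ hD]
      refine congrArg Sum.inl (Subtype.ext ?_)
      change σ i (Structure.funMap f fun k => (w' k : M)) = Structure.funMap f fun k => (w k : M)
      rw [hwσ]
      exact StrongHomClass.map_fun (σ i) f _
    · change Structure.RelMap R (fun k => (w k : M)) ↔ Structure.RelMap R fun k => (w' k : M)
      rw [hwσ]
      exact StrongHomClass.map_rel (σ i) R _
  have hcohF : ∀ i i' {n : ℕ} (w w' : Fin n → F), (∀ k, jF i (w k) = jF i' (w' k)) →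
      (∀ f : L.Functions n, jF i (Structure.funMap f w) = jF i' (Structure.funMap f w')) ∧
        ∀ R : L.Relations n, Structure.RelMap R w → Structure.RelMap R w' := by
    intro i i' n w w' h
    obtain rfl : w = w' := funext fun k => (hFF i i' _ _ (h k)).1
    refine ⟨fun f => ?_, fun R hR => hR⟩
    by_cases hi : i = i'
    · rw [hi]
    -- Different copies of `F` overlap only inside the substructure `G`, on which all charts agree.
    · exact hGG i i' _ (G.fun_mem f _ fun k => (hFF i i' _ _ (h k)).2.resolve_left hi)
  obtain ⟨str, he, hclosed⟩ := exists_glue (L := L) (F := fun o => S o) j (by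
    rintro (_ | i)
    · exact Sum.inl_injective
    · exact fun x x' h => (hFF i i x x' h).1) (by
    rintro (_ | i) (_ | i') n w w' h
    · obtain rfl : w = w' := funext fun k => Sum.inl_injective (h k)
      exact ⟨fun f => rfl, fun R hR => hR⟩
    · obtain ⟨h1, h2⟩ := hcohX i' w w' fun k => (h k).symm
      exact ⟨fun f => (h1 f).symm, fun R => (h2 R).1⟩
    · obtain ⟨h1, h2⟩ := hcohX i w' w fun k => h k
      exact ⟨h1, fun R => (h2 R).2⟩
    · exact hcohF i i' w w' h)
  choose e he using he
  obtain ⟨h, hh⟩ := hM.exists_embedding hT hZ (e none) X.subtype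
  have hhX : ∀ x : X, h (some (Sum.inl x)) = x := fun x => (congrArg h (he none x)).symm.trans (hh x)
  choose τ hτ using fun i => hM.exists_equiv_of_embedding hT hF (h.comp (e (some i)))
  have hτF : ∀ i (x : F), τ i x = h (some (jF i x)) := fun i x =>
    (hτ i x).trans (congrArg h (he (some i) x))
  refine ⟨τ, fun i x hx => ?_, fun i i' x hx hG => ?_, fun i x hx hxX => ?_, ?_⟩
  · rw [hτF i ⟨x, hDF hx⟩, hjD i ⟨x, hDF hx⟩ hx, hhX]
  · rw [hτF i ⟨x, hx⟩, hτF i' ⟨x, hx⟩, hGG i i' _ hG]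
  · rw [hτF i ⟨x, hx⟩] at hxX
    have := h.injective (hhX ⟨_, hxX⟩)
    exact (hX_eq i ⟨x, hx⟩ _ (Option.some_injective _ this).symm).1
  · intro TX TF hTX hTF hcompat y hy hyT
    -- The union of `TX` and all copies of `TF`, with the absorbing point added, is closed under
    -- functions by compatibility, and it meets `X` exactly in `TX`.
    let T : Set (Option Z) := fun z => match z with
      | none => True
      | some (Sum.inl x) => (x : M) ∈ TX
      | some (Sum.inr (_, x)) => (x : M) ∈ TF
    have hTF' : ∀ i (x : F), some (jF i x) ∈ T ↔ (x : M) ∈ TF := by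
      intro i x
      by_cases hD : (x : M) ∈ D
      · rw [hjD i x hD]
        exact hcompat i x hD
      · by_cases hG : (x : M) ∈ G
        · rw [hjG i x hD hG]; rfl
        · rw [hjN i x hD hG]; rfl
    let T' : L.Substructure (Option Z) := ⟨T, fun {n} f => hclosed T trivial (by
      rintro (_ | i) n f w hw
      · exact TX.fun_mem f _ hw
      · exact (hTF' i _).2 (TF.fun_mem f _ fun k => (hTF' i _).1 (hw k))) f⟩
    have hle : Substructure.closure L ((TX : Set M) ∪ ⋃ i, τ i '' TF) ≤ T'.map h.toHom := by
      rw [Substructure.closure_le]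
      rintro m (hm | hm)
      · exact ⟨some (Sum.inl ⟨m, hTX hm⟩), hm, hhX _⟩
      · obtain ⟨i, x, hx, rfl⟩ := Set.mem_iUnion.1 hm
        exact ⟨some (jF i ⟨x, hTF hx⟩), (hTF' i _).2 hx, (hτF i ⟨x, hTF hx⟩).symm⟩
    obtain ⟨z, hz, hzy⟩ := hle hyT
    have : z = some (Sum.inl ⟨y, hy⟩) := h.injective (hzy.trans (hhX ⟨y, hy⟩).symm)
    rw [this] at hz
    exact hz

end Gluing

/-! ### Algebraic closure and extension for M-dividing independence -/

section Closure

variable {L : FirstOrder.Language.{u, v}} {M : Type w} [L.Structure M] {κ : Cardinal.{w}}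

/-- Over a small set `S` that does not generate `c`, the element `c` has a conjugate outside any
given small set. -/
theorem IsMonster.exists_conj_notMem (hM : IsMonster L M κ) (hT : M ⊨ genericTheory L)
    {S Z : Set M} (hS : #S < κ) (hZ : #Z < κ) {c : M} (hc : c ∉ Substructure.closure L S) :
    ∃ τ : M ≃[L] M, (∀ x ∈ Substructure.closure L S, τ x = x) ∧ τ c ∉ Z := by
  have hκ := hM.aleph0_lt
  obtain ⟨τ, h1, -, h2, -⟩ := hM.exists_amalgam hT (ι := Unit)
    (X := Substructure.closure L (S ∪ Z)) (F := Substructure.closure L (S ∪ {c}))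
    (D := Substructure.closure L S) (G := Substructure.closure L S)
    (hM.mk_closure_lt (mk_union_lt hκ.le hS hZ))
    (hM.mk_closure_lt (mk_union_lt hκ.le hS
      ((Cardinal.mk_singleton c).trans_lt (Cardinal.one_lt_aleph0.trans hκ))))
    (Substructure.closure_mono Set.subset_union_left) (fun _ => Language.Equiv.refl L M)
    (fun _ x hx => Substructure.closure_mono Set.subset_union_left hx)
    (fun i i' h => (h rfl).elim) (fun _ _ _ _ _ => rfl)
  refine ⟨τ (), fun x hx => h1 () x hx, fun h => hc (h2 () c ?_ ?_)⟩
  · exact Substructure.subset_closure (Or.inr rfl)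
  · exact Substructure.subset_closure (Or.inr h)

/-- A finite set of conjugates would be small, hence avoided by a further conjugate. -/
theorem IsMonster.infinite_conj (hM : IsMonster L M κ) (hT : M ⊨ genericTheory L)
    {S : Set M} (hS : #S < κ) {c : M} (hc : c ∉ Substructure.closure L S) :
    {d | ∃ τ : M ≃[L] M, (∀ x ∈ Substructure.closure L S, τ x = x) ∧ τ c = d}.Infinite := by
  intro hfin
  obtain ⟨τ, h1, h2⟩ := hM.exists_conj_notMem hT hS (hfin.lt_aleph0.trans hM.aleph0_lt) hc
  exact h2 ⟨τ, h1, rfl⟩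

/-- Algebraic closure is the generated substructure. -/
theorem IsMonster.acl_eq (hM : IsMonster L M κ) (hT : M ⊨ genericTheory L) (A : Set M) :
    acl L A = Substructure.closure L A := by
  ext c
  constructor
  · rintro ⟨s, hs, hfin, hcs⟩
    -- The set `A` need not be small, but a definition uses only finitely many parameters.
    obtain ⟨A₀, hA₀, hs⟩ := Set.definable_iff_finitely_definable.1 hs
    by_contra hc
    have hc₀ : c ∉ Substructure.closure L (A₀ : Set M) := fun h =>
      hc (Substructure.closure_mono hA₀ h)
    have hA₀κ : #(A₀ : Set M) < κ := (A₀.finite_toSet.lt_aleph0).trans hM.aleph0_lt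
    refine hM.infinite_conj hT hA₀κ hc₀ (hfin.subset ?_)
    rintro _ ⟨τ, hτ, rfl⟩
    obtain ⟨φ, hφ⟩ := Set.definable_iff_exists_formula_sum.1 hs
    have key : ∀ m, m ∈ s ↔
        φ.Realize (Sum.elim (fun a : (A₀ : Set M) => (a : M)) fun _ : Fin 1 => m) := fun m =>
      Set.ext_iff.1 hφ fun _ => m
    rw [key] at hcs ⊢
    rw [← StrongHomClass.realize_formula τ] at hcs
    convert hcs using 1
    funext x
    rcases x with x | x
    · exact (hτ x (Substructure.subset_closure x.2)).symm
    · rfl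
  · intro hc
    obtain ⟨t, ht⟩ := Substructure.mem_closure_iff_exists_term.1 hc
    refine ⟨{c}, ?_, Set.finite_singleton c, rfl⟩
    refine Set.definable_iff_exists_formula_sum.2 ⟨Term.equal (t.relabel Sum.inl)
      (Term.var (Sum.inr 0)), ?_⟩
    ext m
    simp only [Set.mem_ofPred_eq, Formula.realize_equal, Term.realize_relabel, Term.realize_var,
      Sum.elim_comp_inl, Sum.elim_inr, ht]
    exact eq_comm

/-- For C ⊆ C' ⊆ ⟨BC⟩ the closure of C'B is always ⟨BC⟩, so only one inclusion has content. -/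
theorem IsMonster.mIndep_iff (hM : IsMonster L M κ) (hT : M ⊨ genericTheory L) {A C B : Set M} :
    MIndep L A C B ↔ ∀ C' : Set M, C ⊆ C' → C' ⊆ Substructure.closure L (B ∪ C) →
      ∀ x ∈ Substructure.closure L (C' ∪ A), x ∈ Substructure.closure L (B ∪ C) →
        x ∈ Substructure.closure L C' := by
  simp only [MIndep, AlgIndep, hM.acl_eq hT]
  refine forall_congr' fun C' => forall₂_congr fun h1 h2 => ?_
  have hBC : Substructure.closure L (C' ∪ B) = Substructure.closure L (B ∪ C) :=
    le_antisymm (Substructure.closure_le.2 (Set.union_subset h2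
      (Set.subset_union_left.trans Substructure.subset_closure)))
      (Substructure.closure_mono (Set.union_subset Set.subset_union_right
        (h1.trans Set.subset_union_left)))
  rw [hBC]
  refine ⟨fun h x hx hx' => ?_, fun h => Set.Subset.antisymm (fun x hx => h x hx.1 hx.2) ?_⟩
  · exact (Set.ext_iff.1 h x).1 ⟨hx, hx'⟩
  · exact fun x hx => ⟨Substructure.closure_mono Set.subset_union_left hx,
      Substructure.closure_le.2 h2 hx⟩

theorem setEquivOver_image (σ : M ≃[L] M) {B A : Set M} (hσ : ∀ b ∈ B, σ b = b) :
    SetEquivOver L B (σ '' A) A :=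
  ⟨fun a => σ a, by rw [Set.image_eq_range], tp_equiv σ hσ _⟩

theorem IsMonster.exists_equiv_of_setEquivOver (hM : IsMonster L M κ) {B A' A : Set M}
    (hA : #A < κ) (hB : #B < κ) (h : SetEquivOver L B A' A) :
    ∃ σ : M ≃[L] M, (∀ b ∈ B, σ b = b) ∧ σ '' A = A' := by
  obtain ⟨f, rfl, hf⟩ := h
  obtain ⟨σ, h1, h2⟩ := hM.exists_equiv_of_tp_eq hB
    (by rwa [Subtype.range_coe]) hf.symm
  exact ⟨σ, h1, by rw [Set.image_eq_range]; exact congrArg Set.range (funext h2)⟩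

/-- `M`-dividing independence satisfies extension. -/
theorem IsMonster.mIndep_extension (hM : IsMonster L M κ) (hT : M ⊨ genericTheory L) :
    SatisfiesExtension L κ (MIndep L (M := M)) := by
  intro A C B hA hC hB hI B' hB' hBB'
  have hκ := hM.aleph0_lt.le
  rw [hM.mIndep_iff hT] at hI
  let D := Substructure.closure L (B ∪ C)
  let F := Substructure.closure L ((B ∪ C) ∪ A)
  let X := Substructure.closure L (B' ∪ C)
  have hDX : D ≤ X := Substructure.closure_mono (Set.union_subset_union_left _ hBB')
  obtain ⟨τ, h1, -, -, h2⟩ := hM.exists_amalgam hT (ι := Unit) (X := X) (F := F) (D := D) (G := D)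
    (hM.mk_closure_lt (mk_union_lt hκ hB' hC))
    (hM.mk_closure_lt (mk_union_lt hκ (mk_union_lt hκ hB hC) hA))
    (Substructure.closure_mono Set.subset_union_left) (fun _ => Language.Equiv.refl L M)
    (fun _ x hx => hDX hx)
    (fun i i' h => (h rfl).elim) (fun _ _ _ _ _ => rfl)
  refine ⟨τ () '' A, setEquivOver_image _ fun b hb => h1 () b (Substructure.subset_closure hb), ?_⟩
  rw [hM.mIndep_iff hT]
  intro C' hC hC' x hx hxX
  -- The trace of ⟨C'⟩ on `D` is an admissible base for `hI`. It makes ⟨C'⟩ and ⟨C₁A⟩ agree on `D`,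
  -- as amalgamation requires.
  let C₁ : Set M := (Substructure.closure L C' : Set M) ∩ D
  have hCC₁ : C ⊆ C₁ := fun x hx => ⟨Substructure.subset_closure (hC hx),
    Substructure.subset_closure (Or.inr hx)⟩
  refine h2 (Substructure.closure L C') (Substructure.closure L (C₁ ∪ A))
    (Substructure.closure_le.2 hC') (Substructure.closure_le.2 (Set.union_subset
      (fun x hx => Substructure.closure_mono Set.subset_union_left hx.2)
      (Set.subset_union_right.trans Substructure.subset_closure))) ?_ x hxX
    (Substructure.closure_mono (Set.union_subset_union Substructure.subset_closure ?_) hx)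
  · refine fun _ y hy => ⟨fun h => Substructure.subset_closure (Or.inl ⟨h, hy⟩), fun h => ?_⟩
    have := hI C₁ hCC₁ Set.inter_subset_right y h hy
    exact Substructure.closure_le.2 Set.inter_subset_left this
  · exact fun y hy => Set.mem_iUnion.2 ⟨(), Set.image_mono
      (Set.subset_union_right.trans Substructure.subset_closure) hy⟩

theorem closure_image_equiv (σ : M ≃[L] M) (s : Set M) :
    (Substructure.closure L (σ '' s) : Set M) = σ '' Substructure.closure L s := by
  have := Substructure.closure_image (L := L) (s := s) σ.toHom
  exact congrArg (fun S : L.Substructure M => (S : Set M)) this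

theorem equiv_eq_self_of_mem_closure {σ : M ≃[L] M} {s : Set M} (h : ∀ x ∈ s, σ x = x) {x : M}
    (hx : x ∈ Substructure.closure L s) : σ x = x :=
  Hom.eqOn_closure (f := σ.toHom) (g := Hom.id L M) (fun x hx => h x hx) hx

/-- Since σ fixes ⟨BC⟩ pointwise, it moves neither the intermediate bases nor the elements to be
tested. -/
theorem IsMonster.mIndep_of_image (hM : IsMonster L M κ) (hT : M ⊨ genericTheory L)
    {A C B : Set M} {σ : M ≃[L] M} (hσ : ∀ b ∈ B ∪ C, σ b = b) (h : MIndep L (σ '' A) C B) :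
    MIndep L A C B := by
  rw [hM.mIndep_iff hT] at h ⊢
  intro C' h1 h2 x hx hx'
  refine h C' h1 h2 x ?_ hx'
  have hC' : σ '' C' = C' := by
    refine (Set.image_congr fun y hy => equiv_eq_self_of_mem_closure hσ (h2 hy)).trans ?_
    exact Set.image_id _
  rw [← SetLike.mem_coe, ← hC', ← Set.image_union, closure_image_equiv]
  exact ⟨x, hx, equiv_eq_self_of_mem_closure hσ hx'⟩

end Closure

/-! ### Dividing implies M-dividing; limits of conjugates -/

section Dividing

variable {L : FirstOrder.Language.{u, v}} {M : Type w} [L.Structure M] {κ : Cardinal.{w}}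

/-- A formula uses finitely many parameter variables. -/
theorem exists_formula_fin {α β : Type*} (θ : L.Formula (α ⊕ β)) :
    ∃ (m : ℕ) (φ : L.Formula (α ⊕ Fin m)) (b : Fin m → β), ∀ (a : α → M) (v : β → M),
      θ.Realize (Sum.elim a v) ↔ φ.Realize (Sum.elim a (v ∘ b)) := by
  classical
  let V : Finset β := θ.freeVarFinset.preimage Sum.inr Sum.inr_injective.injOn
  let ρ : θ.freeVarFinset → α ⊕ Fin V.card := fun x => match x with
    | ⟨Sum.inl a, _⟩ => Sum.inl a
    | ⟨Sum.inr b, h⟩ => Sum.inr (V.equivFin ⟨b, Finset.mem_preimage.2 h⟩)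
  refine ⟨V.card, BoundedFormula.restrictFreeVar θ ρ, fun i => (V.equivFin.symm i : β),
    fun a v => ?_⟩
  refine (BoundedFormula.realize_restrictFreeVar (φ := θ) (f := ρ)
    (xs := (default : Fin 0 → M)) (Sum.elim a v) ?_).symm
  rintro ⟨x | x, hx⟩
  · rfl
  · simp [ρ]

/-- Dividing independence implies `M`-dividing independence. -/
theorem IsMonster.mIndep_of_dividingIndep (hM : IsMonster L M κ) (hT : M ⊨ genericTheory L)
    {A C B : Set M} (hC : #C < κ) (hB : #B < κ) (h : DividingIndep L A C B) : MIndep L A C B := by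
  classical
  rw [hM.mIndep_iff hT]
  intro C' hCC' hC' x hx hxB
  by_contra hxC'
  refine h ?_
  have hC'κ : #C' < κ := (Cardinal.mk_le_mk_of_subset hC').trans_lt
    (hM.mk_closure_lt (mk_union_lt hM.aleph0_lt.le hB hC))
  obtain ⟨t, ht⟩ := Substructure.mem_closure_iff_exists_term.1 hx
  -- Entries of the term from `A` become object variables and the others parameters; the `Unit` slot
  -- holds the value `x`.
  let ρ : (C' ∪ A : Set M) → A ⊕ (C' ⊕ Unit) := fun y =>
    if h : (y : M) ∈ A then Sum.inl ⟨y, h⟩ else Sum.inr (Sum.inl ⟨y, y.2.resolve_right h⟩)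
  let v : C' ⊕ Unit → M := Sum.elim (fun c => (c : M)) fun _ => x
  let θ : L.Formula (A ⊕ (C' ⊕ Unit)) := Term.equal (t.relabel ρ) (Term.var (Sum.inr (Sum.inr ())))
  obtain ⟨m, φ, b, hφ⟩ := exists_formula_fin (M := M) θ
  have hv : ∀ i, v i ∈ Substructure.closure L (B ∪ C) := by
    rintro (c | _)
    exacts [hC' c.2, hxB]
  have hinf := hM.infinite_conj hT hC'κ hxC'
  let e := hinf.natEmbedding
  choose σ hσ₁ hσ₂ using fun n => (e n).2
  refine ⟨m, φ, v ∘ b, ⟨2, fun n i => σ n (v (b i)), fun n => tp_equiv (σ n) (fun c hc =>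
    hσ₁ n c (Substructure.subset_closure (hCC' hc))) _, ?_⟩, ?_⟩
  -- The conjugations fix `C'`, so a common realization would give one term two distinct values.
  · rintro s hs ⟨a, ha⟩
    obtain ⟨n, n', hne, rfl⟩ := Finset.card_eq_two.1 hs
    have key : ∀ k ∈ ({n, n'} : Finset ℕ),
        t.realize (Sum.elim a v ∘ ρ) = e k := by
      intro k hk
      have h1 := (hφ a (fun i => σ k (v i))).2 (ha k hk)
      rw [Formula.realize_equal, Term.realize_relabel] at h1
      refine Eq.trans ?_ (h1.trans (hσ₂ k))
      congr 1
      funext y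
      by_cases hy : (y : M) ∈ A
      · simp [ρ, hy]
      · simp only [Function.comp_apply, ρ, dif_neg hy, Sum.elim_inr, Sum.elim_inl, v]
        exact (hσ₁ k _ (Substructure.subset_closure (y.2.resolve_right hy))).symm
    exact hne (e.injective (Subtype.ext ((key n (by simp)).symm.trans (key n' (by simp)))))
  -- The parameters lie in ⟨BC⟩ only; terms over `B ∪ C` are substituted to express the formula
  -- inside the type.
  · choose tm htm using fun i => Substructure.mem_closure_iff_exists_term.1 (hv i)
    let ψ : L.Formula (A ⊕ (B ∪ C : Set M)) := BoundedFormula.subst θ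
      (Sum.elim (fun a => Term.var (Sum.inl a)) fun i => (tm i).relabel Sum.inr)
    have hψ : ∀ a : A → M, ψ.Realize (Sum.elim a fun b : (B ∪ C : Set M) => (b : M)) ↔
        θ.Realize (Sum.elim a v) := by
      intro a
      rw [Formula.Realize, BoundedFormula.realize_subst, Formula.Realize]
      refine iff_of_eq (congrArg (fun f => BoundedFormula.Realize θ f default) ?_)
      funext y
      rcases y with y | y
      · rfl
      · simp [Term.realize_relabel, htm]
    refine ⟨{ψ}, ?_, fun a ha => ?_⟩
    · rw [Finset.coe_singleton, Set.singleton_subset_iff]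
      refine (hψ _).2 ?_
      rw [Formula.realize_equal, Term.realize_relabel]
      refine Eq.trans ?_ ht
      congr 1
      funext y
      by_cases hy : (y : M) ∈ A
      · simp [ρ, hy]
      · simp [ρ, hy, v]
    · exact (hφ a v).1 ((hψ a).1 (ha ψ (by simp)))

/-- The limit type of a sequence of conjugates of `D` along a nonprincipal ultrafilter is realized
over any small set by a conjugate of `D`. -/
theorem IsMonster.exists_limit_equiv (hM : IsMonster L M κ) (hT : M ⊨ genericTheory L)
    {D W : Set M} (hD : #D < κ) (hW : #W < κ) (σ : ℕ → M ≃[L] M) (U : Ultrafilter ℕ) :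
    ∃ τ : M ≃[L] M, ∀ χ : L.Formula (D ⊕ W),
      χ.Realize (Sum.elim (fun x : D => τ x) fun b : W => (b : M)) →
        ∃ᶠ n in U, χ.Realize (Sum.elim (fun x : D => σ n x) fun b : W => (b : M)) := by
  have := nonempty_of_models_genericTheory hT
  obtain ⟨e, he⟩ := hM.saturated.exists_realize hM.aleph0_lt.le hD hW
    {χ | ∀ᶠ n in U, χ.Realize (Sum.elim (fun x : D => σ n x) fun b : W => (b : M))} (by
      intro s hs
      have : ∀ᶠ n in U, ∀ χ ∈ s,
          χ.Realize (Sum.elim (fun x : D => σ n x) fun b : W => (b : M)) :=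
        (Filter.eventually_all_finset s).2 fun χ hχ => hs hχ
      obtain ⟨n, hn⟩ := this.exists
      exact ⟨_, hn⟩)
  have he' : ∀ χ : L.Formula (D ⊕ W), χ.Realize (Sum.elim e fun b : W => (b : M)) →
      ∃ᶠ n in U, χ.Realize (Sum.elim (fun x : D => σ n x) fun b : W => (b : M)) := by
    intro χ hχ hn
    have := he (∼χ) (hn.mono fun n hn => Formula.realize_not.2 hn)
    exact Formula.realize_not.1 this hχ
  -- Each `σ n` is an automorphism, so the limit has the type of `D` over ∅ and is a conjugate.
  have hconj : ∀ φ : L.Formula D, φ.Realize e → φ.Realize fun x : D => (x : M) := by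
    intro φ hφ
    obtain ⟨n, hn⟩ := (he' (φ.relabel Sum.inl) (by
      rwa [Formula.realize_relabel, Sum.elim_comp_inl])).exists
    rw [Formula.realize_relabel, Sum.elim_comp_inl] at hn
    exact (StrongHomClass.realize_formula (σ n) φ).1 hn
  obtain ⟨τ, hτ⟩ := hM.exists_equiv_of_realize_iff (a := fun x : D => (x : M)) (a' := e)
    (by rwa [Subtype.range_coe]) (fun φ => ⟨fun h => by_contra fun hn =>
      Formula.realize_not.1 (hconj (∼φ) (Formula.realize_not.2 hn)) h, hconj φ⟩)
  rw [← show (fun x : D => τ x) = e from funext hτ] at he'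
  exact ⟨τ, he'⟩

end Dividing

/-! ### Limit sequences; M-dividing and dividing coincide; consequences -/

section Morley

variable {L : FirstOrder.Language.{u, v}} {M : Type w} [L.Structure M] {κ : Cardinal.{w}}

/-- From a sequence of conjugates of `D`, an ultrafilter yields a sequence whose members realize the
limit type over increasing small sets containing all the preceding members. -/
theorem IsMonster.exists_limit_sequence (hM : IsMonster L M κ) (hT : M ⊨ genericTheory L)
    {D : Set M} (hD : #D < κ) (σ : ℕ → M ≃[L] M) (U : Ultrafilter ℕ) :
    ∃ (W : ℕ → Set M) (e : ℕ → M ≃[L] M), (∀ k, #(W k) < κ) ∧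
      (∀ n k, ∀ x ∈ D, σ n x ∈ W k) ∧ (∀ i k, i < k → ∀ x ∈ D, e i x ∈ W k) ∧
      ∀ k, ∀ χ : L.Formula (D ⊕ W k),
        χ.Realize (Sum.elim (fun x : D => e k x) fun b : W k => (b : M)) →
          ∃ᶠ n in U, χ.Realize (Sum.elim (fun x : D => σ n x) fun b : W k => (b : M)) := by
  have hκ := hM.aleph0_lt
  choose next hnext using fun W : {W : Set M // #W < κ} => hM.exists_limit_equiv hT hD W.2 σ U
  let W₀ : Set M := Set.range fun p : ℕ × D => σ p.1 p.2
  have hW₀ : #W₀ < κ := by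
    refine Cardinal.mk_range_le.trans_lt ?_
    rw [Cardinal.mk_prod]
    exact Cardinal.mul_lt_of_lt hκ.le (by simpa using hκ) (by simpa using hD)
  let W : ℕ → {W : Set M // #W < κ} := fun k => Nat.rec ⟨W₀, hW₀⟩
    (fun _ V => ⟨V.1 ∪ next V '' D, mk_union_lt hκ.le V.2 (Cardinal.mk_image_le.trans_lt hD)⟩) k
  have hW : ∀ k, (W (k + 1)).1 = (W k).1 ∪ next (W k) '' D := fun k => rfl
  have hmono : Monotone fun k => (W k).1 := monotone_nat_of_le_succ fun k => by
    rw [hW]; exact Set.subset_union_left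
  refine ⟨fun k => (W k).1, fun k => next (W k), fun k => (W k).2, fun n k x hx => ?_,
    fun i k hik x hx => ?_, fun k => hnext (W k)⟩
  · exact hmono (Nat.zero_le k) ⟨(n, ⟨x, hx⟩), rfl⟩
  · refine hmono (Nat.succ_le_of_lt hik) ?_
    change _ ∈ (W (i + 1)).1
    rw [hW]
    exact Or.inr ⟨x, hx, rfl⟩

/-- `k`-inconsistency passes from a sequence of conjugates to a limit sequence. -/
theorem limit_sequence_inconsistent [Nonempty M] {A D : Set M} {σ e : ℕ → M ≃[L] M}
    {W : ℕ → Set M} (hσ : ∀ n k, ∀ x ∈ D, σ n x ∈ W k)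
    (he : ∀ i k, i < k → ∀ x ∈ D, e i x ∈ W k)
    (hlim : ∀ k, ∀ χ : L.Formula (D ⊕ W k),
      χ.Realize (Sum.elim (fun x : D => e k x) fun b : W k => (b : M)) →
        ∃ᶠ n in Filter.hyperfilter ℕ,
          χ.Realize (Sum.elim (fun x : D => σ n x) fun b : W k => (b : M)))
    {k : ℕ} (θ : L.Formula (A ⊕ D))
    (hk : ∀ s : Finset ℕ, s.card = k →
      ¬ ∃ a : A → M, ∀ n ∈ s, θ.Realize (Sum.elim a fun x : D => σ n x)) :
    ∀ (j : ℕ) (s : Finset ℕ), s.card + j = k → ¬ ∃ a : A → M,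
      (∀ n ∈ s, θ.Realize (Sum.elim a fun x : D => σ n x)) ∧
        ∀ i < j, θ.Realize (Sum.elim a fun x : D => e i x) := by
  -- Induction trades the last limit member `e j` for a member `σ n` of the original sequence; the
  -- ultrafilter is nonprincipal, so `n` can be taken outside `s`.
  intro j
  induction j with
  | zero => exact fun s hs ⟨a, ha, _⟩ => hk s hs ⟨a, ha⟩
  | succ j ih =>
    rintro s hs ⟨a, ha₁, ha₂⟩
    let θ₁ : L.Formula (A ⊕ (D ⊕ W j)) := θ.relabel (Sum.map id Sum.inl)
    let θ₂ : L.Formula (A ⊕ (D ⊕ W j)) := Formula.iInf fun n : s =>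
      θ.relabel (Sum.map id fun x : D => Sum.inr ⟨σ n x, hσ n j x x.2⟩)
    let θ₃ : L.Formula (A ⊕ (D ⊕ W j)) := Formula.iInf fun i : Fin j =>
      θ.relabel (Sum.map id fun x : D => Sum.inr ⟨e i x, he i j i.2 x x.2⟩)
    obtain ⟨χ, hχ⟩ := exists_formula_exists (M := M) (θ₁ ⊓ (θ₂ ⊓ θ₃))
    have hχ' : ∀ τ : M ≃[L] M,
        χ.Realize (Sum.elim (fun x : D => τ x) fun b : W j => (b : M)) ↔ ∃ a : A → M,
          θ.Realize (Sum.elim a fun x : D => τ x) ∧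
          (∀ n ∈ s, θ.Realize (Sum.elim a fun x : D => σ n x)) ∧
            ∀ i < j, θ.Realize (Sum.elim a fun x : D => e i x) := by
      intro τ
      refine (hχ _).trans (exists_congr fun a => ?_)
      rw [Formula.realize_inf, Formula.realize_inf]
      refine and_congr ?_ (and_congr ?_ ?_)
      · simp only [θ₁, Formula.realize_relabel, Sum.elim_comp_map, Function.comp_id,
          Sum.elim_comp_inl]
      · simp only [θ₂, Formula.realize_iInf, Formula.realize_relabel, Sum.elim_comp_map,
          Function.comp_id, Subtype.forall]
        rfl
      · simp only [θ₃, Formula.realize_iInf, Formula.realize_relabel, Sum.elim_comp_map,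
          Function.comp_id, Fin.forall_iff]
        rfl
    have hfreq := hlim j χ ((hχ' (e j)).2 ⟨a, ha₂ j j.lt_succ_self, ha₁,
      fun i hi => ha₂ i (hi.trans j.lt_succ_self)⟩)
    obtain ⟨n, hn, hns⟩ := (hfreq.and_eventually s.finite_toSet.compl_mem_hyperfilter).exists
    obtain ⟨a', h₁, h₂, h₃⟩ := (hχ' (σ n)).1 hn
    refine ih (insert n s) ?_ ⟨a', fun n' hn' => ?_, h₃⟩
    · rw [Finset.card_insert_of_notMem hns]
      omega
    · rcases Finset.mem_insert.1 hn' with rfl | hn'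
      exacts [h₁, h₂ n' hn']

/-- Distinct members of a limit sequence only meet at points where the sequence is constant. -/
theorem limit_sequence_eq {D : Set M} {σ e : ℕ → M ≃[L] M}
    {W : ℕ → Set M} (hσ : ∀ n k, ∀ x ∈ D, σ n x ∈ W k)
    (he : ∀ i k, i < k → ∀ x ∈ D, e i x ∈ W k) {U : Ultrafilter ℕ}
    (hlim : ∀ k, ∀ χ : L.Formula (D ⊕ W k),
      χ.Realize (Sum.elim (fun x : D => e k x) fun b : W k => (b : M)) →
        ∃ᶠ n in U, χ.Realize (Sum.elim (fun x : D => σ n x) fun b : W k => (b : M)))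
    {i i' : ℕ} (hii' : i < i') {x x' : M} (hx : x ∈ D) (hx' : x' ∈ D) (h : e i x = e i' x') :
    x = x' ∧ ∀ l, e l x = e i x := by
  have hfreq : ∃ᶠ n in U, σ n x' = e i x := by
    have := hlim i' (Term.equal (Term.var (Sum.inl ⟨x', hx'⟩))
      (Term.var (Sum.inr ⟨e i x, he i i' hii' x hx⟩))) (by
        rw [Formula.realize_equal]; exact h.symm)
    simpa only [Formula.realize_equal, Term.realize_var, Sum.elim_inl, Sum.elim_inr] using this
  have hev : ∀ᶠ n in U, σ n x' = e i x := Ultrafilter.frequently_iff_eventually.1 hfreq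
  obtain ⟨n, hn⟩ := hfreq.exists
  have hconst : ∀ l, e l x' = e i x := by
    intro l
    by_contra hne
    -- The common value is some `σ n x'`, hence a parameter at every stage, so the same limit
    -- equation holds for every `l`.
    have hW : e i x ∈ W l := hn ▸ hσ n l x' hx'
    have := hlim l (∼(Term.equal (Term.var (Sum.inl ⟨x', hx'⟩))
      (Term.var (Sum.inr ⟨e i x, hW⟩)))) (by
        rw [Formula.realize_not, Formula.realize_equal]; exact hne)
    simp only [Formula.realize_not, Formula.realize_equal, Term.realize_var, Sum.elim_inl,
      Sum.elim_inr] at this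
    exact this (hev.mono fun n hn => not_not.2 hn)
  obtain rfl : x' = x := (e i).injective (hconst i)
  exact ⟨rfl, hconst⟩

/-- `M`-dividing independence implies dividing independence. -/
theorem IsMonster.dividingIndep_of_mIndep (hM : IsMonster L M κ) (hT : M ⊨ genericTheory L)
    {A C B : Set M} (hA : #A < κ) (hC : #C < κ) (hB : #B < κ) (hI : MIndep L A C B) :
    DividingIndep L A C B := by
  rintro ⟨m, φ, b, ⟨k, bs, hbs, hk⟩, s, hs, himp⟩
  have := nonempty_of_models_genericTheory hT
  have hκ := hM.aleph0_lt
  rw [hM.mIndep_iff hT] at hI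
  have hBC : #(B ∪ C : Set M) < κ := mk_union_lt hκ.le hB hC
  choose σ hσC hσb using fun n => hM.exists_equiv_of_tp_eq hC
    ((Set.finite_range b).lt_aleph0.trans hκ) (hbs n).symm
  let D := Substructure.closure L (B ∪ C)
  have hD : #D < κ := hM.mk_closure_lt hBC
  let θ : L.Formula (A ⊕ D) := Formula.iInf fun ψ : s =>
    ψ.1.relabel (Sum.map id fun x : (B ∪ C : Set M) => ⟨x, Substructure.subset_closure x.2⟩)
  have hθ : ∀ (a : A → M) (τ : M ≃[L] M), θ.Realize (Sum.elim a fun x : D => τ x) ↔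
      ∀ ψ ∈ s, ψ.Realize (Sum.elim a fun x : (B ∪ C : Set M) => τ x) := by
    intro a τ
    simp only [θ, Formula.realize_iInf, Formula.realize_relabel, Sum.elim_comp_map,
      Function.comp_id, Subtype.forall]
    rfl
  obtain ⟨W, e, hW, hσW, heW, hlim⟩ :=
    hM.exists_limit_sequence hT (D := (D : Set M)) hD σ (Filter.hyperfilter ℕ)
  have hinc := limit_sequence_inconsistent hσW heW hlim (k := k) θ (by
    rintro t ht ⟨a, ha⟩
    refine hk t ht ⟨a, fun n hn => ?_⟩
    -- The implication is known at the original parameters, so the realization is pulled back along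
    -- `σ n` and pushed forward again.
    have h1 := himp (fun x => (σ n).symm (a x)) fun ψ hψ => by
      have h2 := (hθ a (σ n)).1 (ha n hn) ψ hψ
      rw [← StrongHomClass.realize_formula (σ n)]
      convert h2 using 1
      funext x
      rcases x with x | x
      · exact (σ n).apply_symm_apply _
      · rfl
    have h2 := (StrongHomClass.realize_formula (σ n) φ).2 h1
    convert h2 using 1
    funext x
    rcases x with x | x
    · exact ((σ n).apply_symm_apply _).symm
    · exact (hσb n x).symm) k ∅ (by simp)
  let S : Set M := {x | x ∈ D ∧ ∀ l l', e l x = e l' x}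
  have hSD : S ⊆ D := fun x hx => hx.1
  have heC : ∀ l, ∀ x ∈ C, e l x = x := by
    intro l x hx
    have hxD : x ∈ D := Substructure.subset_closure (Or.inr hx)
    have hxW : x ∈ W l := hσC 0 x hx ▸ hσW 0 l x hxD
    by_contra hne
    obtain ⟨n, hn⟩ := (hlim l (∼(Term.equal (Term.var (Sum.inl ⟨x, hxD⟩))
      (Term.var (Sum.inr ⟨x, hxW⟩)))) (by
        rw [Formula.realize_not, Formula.realize_equal]; exact hne)).exists
    rw [Formula.realize_not, Formula.realize_equal] at hn
    exact hn (hσC n x hx)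
  have hCS : C ⊆ S := fun x hx => ⟨Substructure.subset_closure (Or.inr hx), fun l l' =>
    (heC l x hx).trans (heC l' x hx).symm⟩
  let G := Substructure.closure L (S ∪ A)
  let F := Substructure.closure L ((B ∪ C) ∪ A)
  have hdisj : ∀ i i', i < i' → ∀ x ∈ D, ∀ x' ∈ D, e i x = e i' x' → x = x' ∧ x ∈ G := by
    intro i i' hii' x hx x' hx' h
    obtain ⟨h1, h2⟩ := limit_sequence_eq hσW heW hlim hii' hx hx' h
    exact ⟨h1, Substructure.subset_closure
      (Or.inl ⟨hx, fun l l' => (h2 l).trans (h2 l').symm⟩)⟩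
  obtain ⟨τ, hτD, hτG, -⟩ := hM.exists_amalgam hT (ι := Fin k)
    (X := Substructure.closure L (W k)) (F := F) (D := D) (G := G)
    (hM.mk_closure_lt (hW k)) (hM.mk_closure_lt (mk_union_lt hκ.le hBC hA))
    (Substructure.closure_mono Set.subset_union_left) (fun i => e i)
    (fun i x hx => Substructure.subset_closure (heW i k i.2 x hx))
    (fun i i' hne x hx x' hx' h => by
      rcases lt_or_gt_of_ne (Fin.val_ne_of_ne hne) with hlt | hlt
      · exact hdisj i i' hlt x hx x' hx' h
      · obtain ⟨rfl, h2⟩ := hdisj i' i hlt x' hx' x hx h.symm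
        exact ⟨rfl, h2⟩)
    (fun i i' x hx hxG => by
      -- The only use of independence: ⟨SA⟩ meets `D` inside ⟨S⟩, where all members of the sequence
      -- agree.
      have hxS := hI S hCS hSD x hxG hx
      exact Hom.eqOn_closure (f := (e i).toHom) (g := (e i').toHom) (fun y hy => hy.2 i i') hxS)
  -- The copies of `A` all coincide because A ⊆ G, so the first one serves for every index. The
  -- other branch, for k = 0, has no condition to meet.
  refine hinc ⟨fun x => if h : 0 < k then τ ⟨0, h⟩ x else x, by simp, fun i hi => ?_⟩
  refine (hθ _ (e i)).2 fun ψ hψ => ?_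
  have h1 := (StrongHomClass.realize_formula (τ ⟨i, hi⟩) ψ).2 (hs hψ)
  convert h1 using 1
  funext x
  rcases x with x | x
  · change dite _ _ _ = τ ⟨i, hi⟩ x
    rw [dif_pos (Nat.zero_lt_of_lt hi)]
    exact hτG _ _ x (Substructure.subset_closure (Or.inr x.2))
      (Substructure.subset_closure (Or.inr x.2))
  · exact (hτD ⟨i, hi⟩ x (Substructure.subset_closure x.2)).symm

theorem IsMonster.dividingIndep_iff (hM : IsMonster L M κ) (hT : M ⊨ genericTheory L)
    {A C B : Set M} (hA : #A < κ) (hC : #C < κ) (hB : #B < κ) :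
    DividingIndep L A C B ↔ MIndep L A C B :=
  ⟨hM.mIndep_of_dividingIndep hT hC hB, hM.dividingIndep_of_mIndep hT hA hC hB⟩

theorem mk_lt_of_setEquivOver {B A' A : Set M} (hA : #A < κ) (h : SetEquivOver L B A' A) :
    #A' < κ := by
  obtain ⟨f, rfl, -⟩ := h
  exact Cardinal.mk_range_le.trans_lt hA

theorem IsMonster.dividingIndep_extension (hM : IsMonster L M κ) (hT : M ⊨ genericTheory L) :
    SatisfiesExtension L κ (DividingIndep L (M := M)) := by
  intro A C B hA hC hB hI B' hB' hBB'
  obtain ⟨A', hA', hI'⟩ := hM.mIndep_extension hT A C B hA hC hB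
    ((hM.dividingIndep_iff hT hA hC hB).1 hI) B' hB' hBB'
  exact ⟨A', hA', (hM.dividingIndep_iff hT (mk_lt_of_setEquivOver hA hA') hC hB').2 hI'⟩

/-- One direction is extension; the other takes B' = B and transports the result back along an
automorphism over BC. -/
theorem IsMonster.thornIndep_iff (hM : IsMonster L M κ) (hT : M ⊨ genericTheory L) :
    AgreeOnSmall κ (MIndep L (M := M)) (ThornIndep L κ) := by
  refine fun A C B hA hC hB => ⟨fun h => hM.mIndep_extension hT A C B hA hC hB h, fun h => ?_⟩
  obtain ⟨A', hA', hI⟩ := h B hB subset_rfl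
  obtain ⟨σ, hσ, rfl⟩ := hM.exists_equiv_of_setEquivOver hA
    (mk_union_lt hM.aleph0_lt.le hB hC) hA'
  exact hM.mIndep_of_image hT hσ hI

theorem TypeDivides.typeForks {C : Set M} {α : Type*} {B : Set M} {p : Set (L.Formula (α ⊕ B))}
    (h : TypeDivides C p) : TypeForks C p := by
  obtain ⟨m, φ, b, hdiv, s, hs, himp⟩ := h
  exact ⟨1, fun _ => m, fun _ => φ, fun _ => b, fun _ => hdiv, s, hs, fun a ha => ⟨0, himp a ha⟩⟩

/-- Dividing is inherited along a change of object variables. -/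
theorem Divides.relabel {C : Set M} {α β : Type*} {m : ℕ} {φ : L.Formula (α ⊕ Fin m)}
    {b : Fin m → M} (h : Divides C φ b) (f : α → β) :
    Divides C (φ.relabel (Sum.map f id) : L.Formula (β ⊕ Fin m)) b := by
  obtain ⟨k, bs, hbs, hk⟩ := h
  refine ⟨k, bs, hbs, fun s hs => fun ⟨a, ha⟩ => hk s hs ⟨a ∘ f, fun i hi => ?_⟩⟩
  have := ha i hi
  rwa [Formula.realize_relabel, Sum.elim_comp_map, Function.comp_id] at this

/-- Extending to the parameters of all the disjuncts gives a realization whose type still does not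
divide, yet it satisfies one of the dividing disjuncts. -/
theorem IsMonster.forkingIndep_iff (hM : IsMonster L M κ) (hT : M ⊨ genericTheory L) :
    AgreeOnSmall κ (DividingIndep L (M := M)) (ForkingIndep L) := by
  refine fun A C B hA hC hB => ⟨fun h => ?_, fun h hd => h hd.typeForks⟩
  rintro ⟨n, m, φ, b, hdiv, s, hs, himp⟩
  have hκ := hM.aleph0_lt
  let Z : Set M := ⋃ i, Set.range (b i)
  have hZ : #Z < κ := (Set.finite_iUnion fun i => Set.finite_range (b i)).lt_aleph0.trans hκ
  obtain ⟨A', ⟨f, hf, htp⟩, hI⟩ := hM.dividingIndep_extension hT A C B hA hC hB h (B ∪ Z)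
    (mk_union_lt hκ.le hB hZ) Set.subset_union_left
  obtain ⟨i, hi⟩ := himp f fun ψ hψ => by
    have : ψ ∈ tp L (B ∪ C) f := htp ▸ hs hψ
    exact this
  -- The type of `A'` has variables indexed by `A'`, so the disjunct is relabelled along the
  -- enumeration by `A`.
  let f' : A → A' := fun x => ⟨f x, hf ▸ ⟨x, rfl⟩⟩
  refine hI ⟨m i, (φ i).relabel (Sum.map f' id), b i, (hdiv i).relabel f',
    {(φ i).relabel (Sum.map f' fun j =>
      ⟨b i j, Or.inl (Or.inr (Set.mem_iUnion.2 ⟨i, j, rfl⟩))⟩)}, ?_, fun a ha => ?_⟩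
  · rw [Finset.coe_singleton, Set.singleton_subset_iff]
    change Formula.Realize _ _
    rw [Formula.realize_relabel, Sum.elim_comp_map]
    exact hi
  · have := ha _ (Finset.mem_singleton_self _)
    rw [Formula.realize_relabel, Sum.elim_comp_map] at this
    change Formula.Realize _ _
    rw [Formula.realize_relabel, Sum.elim_comp_map]
    exact this

end Morley

end GenericStructure

theorem mainTheorem10 (L : FirstOrder.Language.{u, v}) (M : Type w) [L.Structure M]
    (κ : Cardinal.{w}) (hM : GenericStructure.IsMonster L M κ)
    (hT : M ⊨ GenericStructure.genericTheory L) :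
    GenericStructure.SatisfiesExtension L κ (GenericStructure.MIndep L (M := M)) ∧
    GenericStructure.SatisfiesExtension L κ (GenericStructure.DividingIndep L (M := M)) ∧
    GenericStructure.AgreeOnSmall κ (GenericStructure.MIndep L (M := M))
      (GenericStructure.ThornIndep L κ) ∧
    GenericStructure.AgreeOnSmall κ (GenericStructure.DividingIndep L (M := M))
      (GenericStructure.ForkingIndep L) :=
  ⟨hM.mIndep_extension hT, hM.dividingIndep_extension hT, hM.thornIndep_iff hT,
    hM.forkingIndep_iff hT⟩
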